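/- **Setting.** Let $f\ge 0$ and $N=3f+1$ replicas, at most $f$ of which are Byzantine (they may sign arbitrary messages, but cannot forge signatures of correct replicas); the network is asynchronous and hashes are collision free. Let $\mathit{conflict}$ be a symmetric relation on client requests. Every replica $r$ owns slots $\langle r,0\rangle,\langle r,1\rangle,\dots$. Dependency sets are compact: for each replica they name at most one, the latest, slot, and all earlier slots of that replica are implicitly included. *Agreement* (without checkpointing), separately for each slot. The coordinator of the slot proposes a request for its lowest unused slot with the set of slots of all conflicting requests known to it and a quorum $F$ of $2f$ other replicas (DepPropose); each follower accepts only the first valid proposal for a slot, and, if it is in $F$, answers with the conflicts known to it (DepVerify). A replica never forgets a known request. A replica holding the proposal and all $2f$ DepVerifys sends a DepCommit if every dependency listed in a DepVerify is listed in at least $f+1$ of them (fp-verified), and otherwise a Prepare in view $-1$. The slot is committed after $2f+1$ matching DepCommits, or after $2f+1$ matching Prepares (rp-prepared, then a Commit is sent) followed by $2f+1$ matching Commits of the same view. In a view change to view $v\ge 0$ each replica reports its newest certificate (fast path: proposal and $2f$ matching DepVerifys; reconciliation path: additionally $2f+1$ Prepares of one view); from $2f+1$ such reports the result is the reconciliation-path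 certificate of highest view, else a fast-path certificate, else a no-op without dependencies, and the reconciliation path resumes with it in view $v$. A replica also regards as committed what $f+1$ replicas report as committed. The committed dependencies $\mathit{deps}(s)$ are the union of the sets in the DepPropose and the DepVerifys. A no-op conflicts with no request. *Execution.* Let $k\ge 0$. At a replica, the window $exp_k$ consists of the slots $\langle r,n\rangle$ with $n<e_r+k$, where $\langle r,e_r\rangle$ is the oldest slot of $r$ not yet executed there. $\mathit{rdeps}(v)$ is the graph obtained from $v$ by repeatedly expanding each committed, unexecuted slot $u$ by its edges $u\to d$, $d\in\mathit{deps}(u)$, and each executed slot $u$ by the graph $\mathit{rhist}[u]$ with which it was executed; $\mathit{rdeps}_{exp}(v)$ is the same with all slots outside $exp_k$ ignored. Normal case: if $v$ is unexecuted and $\mathit{rdeps}(v)\subseteq committed\cap exp_k$, the unexecuted strongly connected components $S$ of $\mathit{rdeps}(v)$ are executed in inverse topological order, each sorted by a fixed total order on slots, with $\mathit{rhist}[u]:=\mathit{rdeps}(S)$ for $u\in S$. Unblock case: if the normal case applies to no slot, and $v\in committed\cap exp_k$ is unexecuted with $\mathit{rdeps}_{exp}(v)\subseteq committed$, then only the first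 unexecuted strongly connected component $S$ of $\mathit{rdeps}_{exp}(v)$ is executed, with $\mathit{rhist}[u]:=\mathit{rdeps}_{exp}(S)$ for $u\in S$. **Theorem (Execution Consistency).** All correct replicas execute every pair of committed, conflicting requests in the same relative order. Precisely, in every reachable state of the system: 1. Let $u\ne v$ be slots for which correct replicas have committed conflicting requests. Then $v\in\mathit{deps}(u)$ or $u\in\mathit{deps}(v)$. Moreover, one of the two slots comes first everywhere: either every correct replica that has executed $v$ has executed $u$ before it, or every correct replica that has executed $u$ has executed $v$ before it. 2. If two correct replicas $i,j$ have both executed a slot $v$, then $\mathit{rhist}^i[v]=\mathit{rhist}^j[v]$. -/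

import Mathlib

/-!
A leaderless Byzantine fault-tolerant state-machine replication protocol with `3 f + 1` replicas,
without checkpointing: per-slot agreement (fast path, reconciliation path, view change, catch-up)
and the execution stage, as an asynchronous transition system.

The network is the set of all messages signed so far; a replica may act on any of them at any time
and any number of times (loss, delay, reordering and duplication are thus all covered).  A message
carries its signer; a faulty replica may at any time sign arbitrary messages in its own name and in
no other name.  A hash of a message is modelled by the message itself (no collisions).  A signed
message that is embedded in another one is verified by looking it up among the signed messages.
Timeouts may fire at any time.  The waiting conditions of the protocol, which only delay a correct
replica and serve progress, are not imposed: a correct replica may act without waiting.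
-/

namespace Isos

/-- Replica identifiers. -/
abbrev Rep (f : ℕ) := Fin (3 * f + 1)

/-- An agreement slot: its request coordinator and the coordinator-local counter. -/
structure Slot (f : ℕ) where
  co : Rep f
  seq : ℕ
deriving DecidableEq

/-- A compact dependency set: for every replica the latest slot depended on (`⊥`: none).
All earlier slots of that replica are implicit dependencies, and the union of dependency sets is
the pointwise supremum `⊔`. -/
abbrev Deps (f : ℕ) := Rep f → WithBot ℕ

/-- `d` is one of the (explicit or implicit) dependencies in `D`. -/
def Deps.Has {f : ℕ} (D : Deps f) (d : Slot f) : Prop := (d.seq : WithBot ℕ) ≤ D d.co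

/-- A `DepPropose` together with its client request. It is signed by `slot.co`. -/
structure DepPropose (f : ℕ) (Req : Type) where
  slot : Slot f
  req : Req
  deps : Deps f
  quorum : Finset (Rep f)

/-- What can be agreed on for a slot: the no-op, or a proposal together with the vector of
dependency sets that the followers in its fast-path quorum reported in their `DepVerify`s
(entries outside the quorum are irrelevant). -/
inductive Val (f : ℕ) (Req : Type) where
  | null
  | prop (dp : DepPropose f Req) (dv : Rep f → Deps f)

/-- The request of a value (`none` is the no-op). -/
def Val.req {f : ℕ} {Req : Type} : Val f Req → Option Req
  | .null => none
  | .prop dp _ => some dp.req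

/-- The union of the dependency sets of the `DepPropose` and of all the `DepVerify`s. -/
def Val.deps {f : ℕ} {Req : Type} : Val f Req → Deps f
  | .null => ⊥
  | .prop dp dv => dp.deps ⊔ dp.quorum.sup dv

/-- Certificates reported in a view change. -/
inductive Cert (f : ℕ) (Req : Type) where
  | none
  | fpc (val : Val f Req)
  /-- the prepared value, the view of the `Prepare`s, and their signers -/
  | rpc (view : ℤ) (val : Val f Req) (signers : Finset (Rep f))

/-- Signed messages. In all but `depPropose` and `newView` the first argument is the signer. -/
inductive Msg (f : ℕ) (Req : Type) where
  | depPropose (dp : DepPropose f Req)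
  | depVerify (i : Rep f) (dp : DepPropose f Req) (D : Deps f)
  | depCommit (i : Rep f) (s : Slot f) (val : Val f Req)
  | prepare (i : Rep f) (view : ℤ) (s : Slot f) (val : Val f Req)
  | commit (i : Rep f) (view : ℤ) (s : Slot f) (val : Val f Req)
  | viewChange (i : Rep f) (view : ℤ) (s : Slot f) (cert : Cert f Req)
  /-- the certificates of the `ViewChange`s signed by the replicas in `Q` are listed in `c` -/
  | newView (view : ℤ) (s : Slot f) (val : Val f Req) (Q : Finset (Rep f)) (c : Rep f → Cert f Req)
  | exec (i : Rep f) (s : Slot f) (req : Option Req) (D : Deps f)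

/-- The coordinator of view `view` of slot `s`. -/
def coordinator {f : ℕ} (s : Slot f) (view : ℤ) : Rep f :=
  ⟨(s.co.val + (max 0 view).toNat) % (3 * f + 1), Nat.mod_lt _ (Nat.succ_pos _)⟩

/-- The signer of a message. -/
def Msg.sender {f : ℕ} {Req : Type} : Msg f Req → Rep f
  | .depPropose dp => dp.slot.co
  | .depVerify i _ _ => i
  | .depCommit i _ _ => i
  | .prepare i _ _ _ => i
  | .commit i _ _ _ => i
  | .viewChange i _ _ _ => i
  | .newView view s _ _ _ => coordinator s view
  | .exec i _ _ _ => i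

/-- A fast-path quorum consists of `2 f` followers. -/
def DepPropose.ValidQuorum {f : ℕ} {Req : Type} (dp : DepPropose f Req) : Prop :=
  dp.quorum.card = 2 * f ∧ dp.slot.co ∉ dp.quorum

/-- A valid proposal and one matching `DepVerify` from each follower in its quorum are signed. -/
def Verified {f : ℕ} {Req : Type} (net : Set (Msg f Req)) (dp : DepPropose f Req)
    (dv : Rep f → Deps f) : Prop :=
  dp.ValidQuorum ∧ Msg.depPropose dp ∈ net ∧ ∀ i ∈ dp.quorum, Msg.depVerify i dp (dv i) ∈ net

/-- Fast-path condition: every dependency listed in some `DepVerify` is listed in at least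
`f + 1` of them. -/
def FastMatch {f : ℕ} {Req : Type} (dp : DepPropose f Req) (dv : Rep f → Deps f) : Prop :=
  ∀ i ∈ dp.quorum, ∀ (l : Rep f) (n : ℕ), dv i l = (n : WithBot ℕ) →
    f + 1 ≤ (dp.quorum.filter fun j => dv j l = (n : WithBot ℕ)).card

/-- Validity of a certificate in a `ViewChange` for view `view` of slot `s`. -/
def ValidCert {f : ℕ} {Req : Type} (net : Set (Msg f Req)) (s : Slot f) (view : ℤ) :
    Cert f Req → Prop
  | .none => True
  | .fpc val => ∃ dp dv, val = .prop dp dv ∧ dp.slot = s ∧ Verified net dp dv ∧ FastMatch dp dv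
  | .rpc w val P =>
      -1 ≤ w ∧ w < view ∧ P.card = 2 * f + 1 ∧ (∀ i ∈ P, Msg.prepare i w s val ∈ net) ∧
      (val = .null ∨ ∃ dp dv, val = .prop dp dv ∧ dp.slot = s ∧ Verified net dp dv)

/-- The result of a view change: a reconciliation-path certificate of the highest view if there is
one, otherwise a fast-path certificate if there is one, otherwise the no-op. -/
def Selects {f : ℕ} {Req : Type} (Q : Finset (Rep f)) (c : Rep f → Cert f Req)
    (val : Val f Req) : Prop :=
  (∃ i ∈ Q, ∃ w P, c i = .rpc w val P ∧ ∀ j ∈ Q, ∀ w' val' P', c j = .rpc w' val' P' → w' ≤ w) ∨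
  ((∀ j ∈ Q, ∀ w' val' P', c j ≠ .rpc w' val' P') ∧ ∃ i ∈ Q, c i = .fpc val) ∨
  ((∀ j ∈ Q, c j = .none) ∧ val = .null)

/-- A correctly computed `NewView`, based on `2 f + 1` valid `ViewChange`s. -/
def ValidNewView {f : ℕ} {Req : Type} (net : Set (Msg f Req)) (s : Slot f) (view : ℤ)
    (val : Val f Req) (Q : Finset (Rep f)) (c : Rep f → Cert f Req) : Prop :=
  Q.card = 2 * f + 1 ∧
  (∀ i ∈ Q, Msg.viewChange i view s (c i) ∈ net ∧ ValidCert net s view (c i)) ∧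
  Selects Q c val

/-- Progress of a slot at a replica. -/
inductive Phase where
  | fresh
  | proposed
  | fpVerified
  | fpCommitted
  | rpVerified
  | rpPrepared
  | rpCommitted
  | viewChange

/-- State of a slot at a replica. -/
structure SlotState (f : ℕ) (Req : Type) where
  view : ℤ
  phase : Phase
  /-- the accepted proposal -/
  dp : Option (DepPropose f Req)
  /-- the verified value, or the one of the current view -/
  val : Val f Req
  /-- signers of the collected `Prepare`s -/
  preps : Finset (Rep f)
  cert : Cert f Req
  /-- the committed request (`some none` for the no-op) and its dependencies -/
  committed : Option (Option Req × Deps f)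

/-- The certificate to be reported when leaving the current view: a new one if the current view was
fp-verified or rp-prepared, and the old one otherwise. -/
def SlotState.newCert {f : ℕ} {Req : Type} (ss : SlotState f Req) : Cert f Req :=
  match ss.phase with
  | .fpVerified | .fpCommitted => .fpc ss.val
  | .rpPrepared | .rpCommitted => .rpc ss.view ss.val ss.preps
  | _ => ss.cert

/-- Dependency graphs between slots. -/
structure DepGraph (f : ℕ) where
  nodes : Set (Slot f)
  edges : Set (Slot f × Slot f)

/-- State of a replica. -/
structure Local (f : ℕ) (Req : Type) where
  slots : Slot f → SlotState f Req
  /-- all requests that the replica has learned so far, with their slots -/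
  known : Set (Slot f × Req)
  /-- the executed slots in the order of their execution -/
  log : List (Slot f)
  /-- the dependency graph with which a slot was executed -/
  rhist : Slot f → Option (DepGraph f)

namespace Local

variable {f : ℕ} {Req : Type}

def setSlot (L : Local f Req) (s : Slot f) (ss : SlotState f Req) : Local f Req :=
  { L with slots := Function.update L.slots s ss }

/-- Remember the request `q` of slot `s` (nothing to do for the no-op). -/
def learn (L : Local f Req) (s : Slot f) (q : Option Req) : Local f Req :=
  { L with known := L.known ∪ {p | p.1 = s ∧ q = some p.2} }

/-- `D` is the compact set of the conflicts of `r`: for each replica, its latest known slot with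
a conflicting request. -/
def IsConflicts (conflict : Req → Req → Prop) (L : Local f Req) (r : Req) (D : Deps f) : Prop :=
  ∀ l, IsLUB {x : WithBot ℕ | ∃ (n : ℕ) (r' : Req),
    x = (n : WithBot ℕ) ∧ ((⟨l, n⟩ : Slot f), r') ∈ L.known ∧ conflict r r'} (D l)

/-- The committed slots. -/
def committedSet (L : Local f Req) : Set (Slot f) := {s | (L.slots s).committed.isSome}

/-- The executed slots. -/
def executed (L : Local f Req) : Set (Slot f) := {s | s ∈ L.log}

/-- `d` is a dependency of the committed slot `s`. -/
def DependsOn (L : Local f Req) (s d : Slot f) : Prop :=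
  ∃ q D, (L.slots s).committed = some (q, D) ∧ Deps.Has D d

/-- Counter of the oldest slot of coordinator `l` that is not yet executed. -/
noncomputable def exp (L : Local f Req) (l : Rep f) : ℕ := sInf {n | (⟨l, n⟩ : Slot f) ∉ L.log}

/-- The execution window of `k` slots per coordinator (together with everything before it). -/
def window (L : Local f Req) (k : ℕ) : Set (Slot f) := {s | s.seq < L.exp s.co + k}

/-- The slots of the dependency graph that starts from the slots in `R` and ignores slots outside
of `W`: slots that are not executed are expanded through their dependencies, executed ones through
the dependency graph with which they were executed. -/
inductive InGraph (L : Local f Req) (W R : Set (Slot f)) : Slot f → Prop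
  | root {v : Slot f} : v ∈ R → v ∈ W → InGraph L W R v
  | dep {u d : Slot f} : InGraph L W R u → u ∉ L.executed → L.DependsOn u d → d ∈ W →
      InGraph L W R d
  | hist {u d : Slot f} {g : DepGraph f} : InGraph L W R u → L.rhist u = some g → d ∈ g.nodes →
      InGraph L W R d

def depGraph (L : Local f Req) (W R : Set (Slot f)) : DepGraph f where
  nodes := {v | L.InGraph W R v}
  edges := {e | L.InGraph W R e.1 ∧ e.1 ∉ L.executed ∧ L.DependsOn e.1 e.2 ∧ e.2 ∈ W} ∪
    {e | ∃ u g, L.InGraph W R u ∧ L.rhist u = some g ∧ e ∈ g.edges}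

/-- The full dependency graph. -/
def rdeps (L : Local f Req) (R : Set (Slot f)) : DepGraph f := L.depGraph Set.univ R

/-- The dependency graph without the slots outside the execution window. -/
def rdepsExp (L : Local f Req) (k : ℕ) (R : Set (Slot f)) : DepGraph f := L.depGraph (L.window k) R

/-- `v` can be executed by the normal case. -/
def NormalOk (L : Local f Req) (k : ℕ) (v : Slot f) : Prop :=
  v ∉ L.executed ∧ (L.rdeps {v}).nodes ⊆ L.committedSet ∩ L.window k

/-- `v` can be executed by the unblock case. -/
def UnblockOk (L : Local f Req) (k : ℕ) (v : Slot f) : Prop :=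
  v ∉ L.executed ∧ v ∈ L.committedSet ∩ L.window k ∧ (L.rdepsExp k {v}).nodes ⊆ L.committedSet

/-- Execute the slots in the list one after the other, and record the graph used. -/
def run (L : Local f Req) (vs : List (Slot f)) (g : DepGraph f) : Local f Req :=
  { L with log := L.log ++ vs, rhist := fun v => if v ∈ vs then some g else L.rhist v }

end Local

/-- Reachability in a dependency graph (in zero or more steps). -/
def DepGraph.Reaches {f : ℕ} (g : DepGraph f) : Slot f → Slot f → Prop :=
  Relation.ReflTransGen fun u v => (u, v) ∈ g.edges

/-- `S` is a strongly connected component of `g`. -/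
def DepGraph.IsSCC {f : ℕ} (g : DepGraph f) (S : Set (Slot f)) : Prop :=
  ∃ v ∈ g.nodes, S = {u | u ∈ g.nodes ∧ g.Reaches v u ∧ g.Reaches u v}

/-- `S` can come first among the not yet executed strongly connected components of `g` in inverse
topological order: everything else that it reaches has been executed. -/
def DepGraph.IsNextSCC {f : ℕ} (g : DepGraph f) (executed S : Set (Slot f)) : Prop :=
  g.IsSCC S ∧ Disjoint S executed ∧ ∀ u ∈ S, ∀ d, g.Reaches u d → d ∈ S ∨ d ∈ executed

/-- `LocalStep conflict k i net L L' out`: the correct replica `i` in state `L` may move to state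
`L'` and sign the messages `out` when the messages in `net` have been signed.  The linear order on
the slots is the one by which strongly connected components are sorted. -/
inductive LocalStep {f : ℕ} {Req : Type} [LinearOrder (Slot f)] (conflict : Req → Req → Prop)
    (k : ℕ) (i : Rep f) (net : Set (Msg f Req)) (L : Local f Req) :
    Local f Req → Set (Msg f Req) → Prop
  /-- The coordinator proposes a request for its lowest unused slot. -/
  | propose (dp : DepPropose f Req) :
      dp.slot.co = i → (L.slots dp.slot).phase = .fresh →
      (∀ n < dp.slot.seq, (L.slots ⟨i, n⟩).phase ≠ .fresh) →
      dp.ValidQuorum → L.IsConflicts conflict dp.req dp.deps →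
      LocalStep conflict k i net L
        ((L.setSlot dp.slot { L.slots dp.slot with phase := .proposed, dp := some dp }).learn
          dp.slot (some dp.req))
        {.depPropose dp}
  /-- A follower accepts the first proposal for a slot, and reports its own dependencies if it
  belongs to the fast-path quorum. -/
  | accept (dp : DepPropose f Req) (D : Deps f) :
      Msg.depPropose dp ∈ net → dp.slot.co ≠ i → (L.slots dp.slot).phase = .fresh →
      dp.ValidQuorum → L.IsConflicts conflict dp.req D →
      LocalStep conflict k i net L
        ((L.setSlot dp.slot { L.slots dp.slot with phase := .proposed, dp := some dp }).learn
          dp.slot (some dp.req))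
        {m | i ∈ dp.quorum ∧ m = .depVerify i dp D}
  /-- All `DepVerify`s have arrived and they match: continue on the fast path. -/
  | fpVerify (s : Slot f) (dp : DepPropose f Req) (dv : Rep f → Deps f) :
      (L.slots s).phase = .proposed → (L.slots s).dp = some dp →
      Verified net dp dv → FastMatch dp dv →
      LocalStep conflict k i net L
        (L.setSlot s { L.slots s with phase := .fpVerified, val := .prop dp dv })
        {.depCommit i s (.prop dp dv)}
  /-- All `DepVerify`s have arrived and they diverge: enter the reconciliation path. -/
  | rpVerify (s : Slot f) (dp : DepPropose f Req) (dv : Rep f → Deps f) :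
      (L.slots s).phase = .proposed → (L.slots s).dp = some dp →
      Verified net dp dv → ¬ FastMatch dp dv →
      LocalStep conflict k i net L
        (L.setSlot s { L.slots s with phase := .rpVerified, val := .prop dp dv })
        {.prepare i (L.slots s).view s (.prop dp dv)}
  | fpCommit (s : Slot f) (Q : Finset (Rep f)) :
      (L.slots s).phase = .fpVerified → Q.card = 2 * f + 1 →
      (∀ j ∈ Q, Msg.depCommit j s (L.slots s).val ∈ net) →
      LocalStep conflict k i net L
        (L.setSlot s { L.slots s with
          phase := .fpCommitted
          committed := some ((L.slots s).val.req, (L.slots s).val.deps) })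
        ∅
  | rpPrepare (s : Slot f) (Q : Finset (Rep f)) :
      (L.slots s).phase = .rpVerified → Q.card = 2 * f + 1 →
      (∀ j ∈ Q, Msg.prepare j (L.slots s).view s (L.slots s).val ∈ net) →
      LocalStep conflict k i net L
        (L.setSlot s { L.slots s with phase := .rpPrepared, preps := Q })
        {.commit i (L.slots s).view s (L.slots s).val}
  | rpCommit (s : Slot f) (Q : Finset (Rep f)) :
      (L.slots s).phase = .rpPrepared → Q.card = 2 * f + 1 →
      (∀ j ∈ Q, Msg.commit j (L.slots s).view s (L.slots s).val ∈ net) →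
      LocalStep conflict k i net L
        (L.setSlot s { L.slots s with
          phase := .rpCommitted
          committed := some ((L.slots s).val.req, (L.slots s).val.deps) })
        ∅
  /-- Abort the current view of a slot in favour of a higher one. -/
  | startViewChange (s : Slot f) (view : ℤ) :
      (L.slots s).view < view →
      LocalStep conflict k i net L
        (L.setSlot s { L.slots s with
          view := view
          phase := .viewChange
          cert := (L.slots s).newCert })
        {.viewChange i view s (L.slots s).newCert}
  /-- The coordinator of the new view announces the result of the view change. -/
  | sendNewView (s : Slot f) (val : Val f Req) (Q : Finset (Rep f)) (c : Rep f → Cert f Req) :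
      (L.slots s).phase = .viewChange → coordinator s (L.slots s).view = i →
      ValidNewView net s (L.slots s).view val Q c →
      LocalStep conflict k i net L L {.newView (L.slots s).view s val Q c}
  /-- Enter the new view and resume with the reconciliation path. -/
  | acceptNewView (s : Slot f) (val : Val f Req) (Q : Finset (Rep f)) (c : Rep f → Cert f Req) :
      (L.slots s).phase = .viewChange → Msg.newView (L.slots s).view s val Q c ∈ net →
      ValidNewView net s (L.slots s).view val Q c →
      LocalStep conflict k i net L
        ((L.setSlot s { L.slots s with phase := .rpVerified, val := val }).learn s val.req)
        {.prepare i (L.slots s).view s val}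
  /-- Report a committed slot to lagging replicas. -/
  | sendExec (s : Slot f) (q : Option Req) (D : Deps f) :
      (L.slots s).committed = some (q, D) →
      LocalStep conflict k i net L L {.exec i s q D}
  /-- Catch up: `f + 1` replicas report the slot as committed. -/
  | learnExec (s : Slot f) (q : Option Req) (D : Deps f) (Q : Finset (Rep f)) :
      Q.card = f + 1 → (∀ j ∈ Q, Msg.exec j s q D ∈ net) →
      LocalStep conflict k i net L
        ((L.setSlot s { L.slots s with committed := some (q, D) }).learn s q)
        ∅
  /-- Normal case execution of a strongly connected component. -/
  | execNormal (v : Slot f) (S : Set (Slot f)) (vs : List (Slot f)) :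
      L.NormalOk k v → (L.rdeps {v}).IsNextSCC L.executed S →
      vs.Pairwise (· < ·) → (∀ s, s ∈ vs ↔ s ∈ S) →
      LocalStep conflict k i net L (L.run vs (L.rdeps S)) ∅
  /-- Unblock case: only if the normal case does not apply to any slot, and only for the first
  strongly connected component. -/
  | execUnblock (v : Slot f) (S : Set (Slot f)) (vs : List (Slot f)) :
      (∀ w, ¬ L.NormalOk k w) → L.UnblockOk k v →
      (L.rdepsExp k {v}).IsNextSCC L.executed S →
      vs.Pairwise (· < ·) → (∀ s, s ∈ vs ↔ s ∈ S) →
      LocalStep conflict k i net L (L.run vs (L.rdepsExp k S)) ∅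

/-- State of the system: the messages signed so far and the states of the replicas (those of
faulty replicas are meaningless). -/
structure State (f : ℕ) (Req : Type) where
  net : Set (Msg f Req)
  loc : Rep f → Local f Req

/-- Nothing has been proposed, signed, committed or executed; all slots are in view `-1`. -/
def State.start (f : ℕ) (Req : Type) : State f Req where
  net := ∅
  loc := fun _ =>
    { slots := fun _ => ⟨-1, .fresh, none, .null, ∅, .none, none⟩
      known := ∅
      log := []
      rhist := fun _ => none }

/-- One step of the system. -/
inductive Step {f : ℕ} {Req : Type} [LinearOrder (Slot f)] (conflict : Req → Req → Prop)
    (k : ℕ) (faulty : Finset (Rep f)) (σ : State f Req) : State f Req → Prop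
  | correct (i : Rep f) (L' : Local f Req) (out : Set (Msg f Req)) :
      i ∉ faulty → LocalStep conflict k i σ.net (σ.loc i) L' out →
      Step conflict k faulty σ ⟨σ.net ∪ out, Function.update σ.loc i L'⟩
  | byzantine (m : Msg f Req) :
      m.sender ∈ faulty → Step conflict k faulty σ ⟨insert m σ.net, σ.loc⟩

/-- The states that can occur in a run of the system. -/
def Reachable {f : ℕ} {Req : Type} [LinearOrder (Slot f)] (conflict : Req → Req → Prop)
    (k : ℕ) (faulty : Finset (Rep f)) (σ : State f Req) : Prop :=
  Relation.ReflTransGen (Step conflict k faulty) (State.start f Req) σ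

/-- Replica `i` has committed request `a` with dependencies `D` for slot `s`. -/
def State.Committed {f : ℕ} {Req : Type} (σ : State f Req) (i : Rep f) (s : Slot f) (a : Req)
    (D : Deps f) : Prop :=
  ((σ.loc i).slots s).committed = some (some a, D)

/-- Replica `i` has executed slot `s`. -/
def State.Executed {f : ℕ} {Req : Type} (σ : State f Req) (i : Rep f) (s : Slot f) : Prop :=
  s ∈ (σ.loc i).log

/-- Replica `i` has executed both slots, `u` before `v`. -/
def State.ExecutedBefore {f : ℕ} {Req : Type} (σ : State f Req) (i : Rep f) (u v : Slot f) :
    Prop :=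
  [u, v].Sublist (σ.loc i).log

end Isos

/-! Agreement. Two sets of `2 f + 1` replicas share a correct one. Hence after a decision on the
reconciliation path in view `w`, every later view change contains a correct report of a certificate
of view at least `w`, and induction on views shows that no other value is prepared from then on
(`Sane.prepared_of_le`). A fast decision survives similarly (`Sane.prepared_of_fastDecided`), though
only up to the `DepVerify`s of faulty followers. These cannot change the union, since each listed
dependency is backed by `f + 1` followers and so by a correct one. Thus request and dependencies of
a slot are unique (`Sane.decided_unique`). For two conflicting requests, the
coordinator-plus-follower quorums share a correct replica, and whichever request it handled later
depends on the other (`AgreeInv.has_or_has`).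

Execution. Both execution cases execute a `Block`: committed fresh slots in the window, strongly
connected, and closed under dependencies in the window up to executed slots. Windows differ between
replicas, but compactness compensates: if a block depends on a slot beyond the window, it also
depends on, and therefore contains, the oldest unexecuted slot of that coordinator
(`Block.exp_mem`). A replica whose window reaches further has already executed that slot. So blocks
that meet coincide (`Block.eq_of_meet`), and an induction over two histories gives every slot the
same block and the same graph everywhere (`History.consistent`).

For the order, let `u` depend on `v`. At each replica that executed `u`, the slot `v` is in the
block of `u`, or was executed before `u`, or lies at least `k` beyond a slot of that block. The last
alternative at one replica forces `u` before `v` everywhere, because the window makes the older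
slot, with its whole block, precede `v`. A common block is sorted in the same way everywhere.
Otherwise `v` precedes `u` everywhere (`execution_order`). -/

namespace Isos

variable {f : ℕ} {Req : Type}

/-! ### Quorum intersection and uniqueness of decisions -/

/-- `2 f + 1` replicas have signed a `Prepare` for the value. -/
def Prepared (net : Set (Msg f Req)) (w : ℤ) (s : Slot f) (val : Val f Req) : Prop :=
  ∃ P : Finset (Rep f), P.card = 2 * f + 1 ∧ ∀ i ∈ P, Msg.prepare i w s val ∈ net

/-- The value is the outcome of a complete verification of a proposal for slot `s`. -/
def VerifiedVal (net : Set (Msg f Req)) (s : Slot f) (val : Val f Req) : Prop :=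
  ∃ dp dv, val = .prop dp dv ∧ dp.slot = s ∧ Verified net dp dv

/-- The value satisfies the conditions of the fast path. -/
def FastVal (net : Set (Msg f Req)) (s : Slot f) (val : Val f Req) : Prop :=
  ∃ dp dv, val = .prop dp dv ∧ dp.slot = s ∧ Verified net dp dv ∧ FastMatch dp dv

/-- `2 f + 1` replicas have signed a `DepCommit` for the value. -/
def FastDecided (net : Set (Msg f Req)) (s : Slot f) (val : Val f Req) : Prop :=
  ∃ Q : Finset (Rep f), Q.card = 2 * f + 1 ∧ ∀ i ∈ Q, Msg.depCommit i s val ∈ net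

/-- `2 f + 1` replicas have signed a `Commit` for the value in view `w`. -/
def SlowDecided (net : Set (Msg f Req)) (w : ℤ) (s : Slot f) (val : Val f Req) : Prop :=
  ∃ Q : Finset (Rep f), Q.card = 2 * f + 1 ∧ ∀ i ∈ Q, Msg.commit i w s val ∈ net

/-- The request `q` with dependencies `D` is decided for slot `s`. -/
def Decided (net : Set (Msg f Req)) (s : Slot f) (q : Option Req) (D : Deps f) : Prop :=
  ∃ val : Val f Req, q = val.req ∧ D = val.deps ∧
    (FastDecided net s val ∨ ∃ w, SlowDecided net w s val)

/-- The messages of correct replicas in `net` obey the agreement protocol. -/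
structure Sane (faulty : Finset (Rep f)) (net : Set (Msg f Req)) : Prop where
  propose_unique : ∀ dp dp' : DepPropose f Req, dp.slot.co ∉ faulty → dp.slot = dp'.slot →
    Msg.depPropose dp ∈ net → Msg.depPropose dp' ∈ net → dp = dp'
  verify_unique : ∀ i ∉ faulty, ∀ (dp dp' : DepPropose f Req) (D D' : Deps f), dp.slot = dp'.slot →
    Msg.depVerify i dp D ∈ net → Msg.depVerify i dp' D' ∈ net → dp = dp' ∧ D = D'
  depCommit_fast : ∀ i ∉ faulty, ∀ s val, Msg.depCommit i s val ∈ net → FastVal net s val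
  depCommit_prepare : ∀ i ∉ faulty, ∀ s val val', Msg.depCommit i s val ∈ net →
    Msg.prepare i (-1) s val' ∉ net
  prepare_unique : ∀ i ∉ faulty, ∀ w s val val', Msg.prepare i w s val ∈ net →
    Msg.prepare i w s val' ∈ net → val = val'
  prepare_view : ∀ i ∉ faulty, ∀ w s val, Msg.prepare i w s val ∈ net → -1 ≤ w
  prepare_verified : ∀ i ∉ faulty, ∀ s val, Msg.prepare i (-1) s val ∈ net → VerifiedVal net s val
  prepare_newView : ∀ i ∉ faulty, ∀ w s val, 0 ≤ w → Msg.prepare i w s val ∈ net →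
    ∃ Q c, ValidNewView net s w val Q c
  commit_prepared : ∀ i ∉ faulty, ∀ w s val, Msg.commit i w s val ∈ net → Prepared net w s val
  viewChange_fast : ∀ i ∉ faulty, ∀ w s val c, Msg.depCommit i s val ∈ net →
    Msg.viewChange i w s c ∈ net → c = .fpc val ∨ ∃ w' val' P, c = .rpc w' val' P
  viewChange_slow : ∀ i ∉ faulty, ∀ w v s val c, Msg.commit i w s val ∈ net →
    Msg.viewChange i v s c ∈ net → w < v → ∃ w' val' P, c = .rpc w' val' P ∧ w ≤ w'

section Quorums

variable {faulty : Finset (Rep f)}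

theorem exists_correct_of_card (hf : faulty.card ≤ f) {Q : Finset (Rep f)} (hQ : f + 1 ≤ Q.card) :
    ∃ i ∈ Q, i ∉ faulty := by
  by_contra! h
  have := Finset.card_le_card (show Q ⊆ faulty from h)
  omega

/-- The overlap has at least `2 (2 f + 1) - (3 f + 1) = f + 1` members. -/
theorem exists_correct_mem_inter (hf : faulty.card ≤ f) {Q Q' : Finset (Rep f)}
    (hQ : Q.card = 2 * f + 1) (hQ' : Q'.card = 2 * f + 1) :
    ∃ i, i ∈ Q ∧ i ∈ Q' ∧ i ∉ faulty := by
  have h1 := Finset.card_union_add_card_inter Q Q'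
  have h2 : (Q ∪ Q').card ≤ 3 * f + 1 := by simpa using Finset.card_le_univ (Q ∪ Q')
  obtain ⟨i, hi, hc⟩ := exists_correct_of_card hf (Q := Q ∩ Q') (by omega)
  rw [Finset.mem_inter] at hi
  exact ⟨i, hi.1, hi.2, hc⟩

/-- Two fast-path quorums of the same faulty coordinator have a correct follower in common. -/
theorem exists_correct_follower (hf : faulty.card ≤ f) {c : Rep f} (hc : c ∈ faulty)
    {Q Q' : Finset (Rep f)} (hQ : Q.card = 2 * f) (hQ' : Q'.card = 2 * f) (hcQ : c ∉ Q)
    (hcQ' : c ∉ Q') : ∃ i, i ∈ Q ∧ i ∈ Q' ∧ i ∉ faulty := by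
  -- Adding the coordinator brings both sets to size `2 f + 1`; being faulty, it is not the correct
  -- common member.
  obtain ⟨i, h1, h2, h3⟩ := exists_correct_mem_inter hf (Q := insert c Q) (Q' := insert c Q')
    (by rw [Finset.card_insert_of_notMem hcQ, hQ]) (by rw [Finset.card_insert_of_notMem hcQ', hQ'])
  have hne : i ≠ c := fun h => h3 (h ▸ hc)
  exact ⟨i, (Finset.mem_insert.1 h1).resolve_left hne, (Finset.mem_insert.1 h2).resolve_left hne, h3⟩

end Quorums

namespace Sane

variable {faulty : Finset (Rep f)} {net : Set (Msg f Req)}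

/-- A correct coordinator proposes once per slot; under a faulty one, a common correct follower has
accepted only one proposal. The entries of faulty followers remain undetermined. -/
theorem verified_unique (h : Sane faulty net) (hf : faulty.card ≤ f) {dp dp' : DepPropose f Req}
    {dv dv' : Rep f → Deps f} (hs : dp.slot = dp'.slot) (hv : Verified net dp dv)
    (hv' : Verified net dp' dv') : dp = dp' ∧ ∀ i ∈ dp.quorum, i ∉ faulty → dv i = dv' i := by
  have hdp : dp = dp' := by
    by_cases hc : dp.slot.co ∈ faulty
    · obtain ⟨i, hi, hi', hcor⟩ := exists_correct_follower hf hc hv.1.1 hv'.1.1 hv.1.2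
        (by rw [hs]; exact hv'.1.2)
      exact (h.verify_unique i hcor _ _ _ _ hs (hv.2.2 i hi) (hv'.2.2 i hi')).1
    · exact h.propose_unique _ _ hc hs hv.2.1 hv'.2.1
  subst hdp
  exact ⟨rfl, fun i hi hc => (h.verify_unique i hc _ _ _ _ rfl (hv.2.2 i hi) (hv'.2.2 i hi)).2⟩

/-- Among the `f + 1` followers that list a dependency in `dv` one is correct, and its entry is the
same in `dv'`. -/
theorem sup_le_of_fastMatch (hf : faulty.card ≤ f) {dp : DepPropose f Req}
    {dv dv' : Rep f → Deps f} (hm : FastMatch dp dv)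
    (he : ∀ i ∈ dp.quorum, i ∉ faulty → dv i = dv' i) :
    dp.quorum.sup dv ≤ dp.quorum.sup dv' := by
  refine Finset.sup_le fun i hi l => ?_
  cases hn : dv i l with
  | bot => exact bot_le
  | coe n =>
    obtain ⟨j, hj, hc⟩ := exists_correct_of_card hf (hm i hi l n hn)
    rw [Finset.mem_filter] at hj
    have : dv' j ≤ dp.quorum.sup dv' := Finset.le_sup hj.1
    have h2 := this l
    rw [← he j hj.1 hc, hj.2] at h2
    exact h2

/-- The values themselves may differ, since a faulty follower can sign several `DepVerify`s. This is
why agreement concerns the request and the union of dependencies. -/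
theorem fastVal_unique (h : Sane faulty net) (hf : faulty.card ≤ f) {s : Slot f}
    {val val' : Val f Req} (hv : FastVal net s val) (hv' : FastVal net s val') :
    val.req = val'.req ∧ val.deps = val'.deps := by
  obtain ⟨dp, dv, rfl, hs, hv, hm⟩ := hv
  obtain ⟨dp', dv', rfl, hs', hv', hm'⟩ := hv'
  obtain ⟨rfl, he⟩ := h.verified_unique hf (hs.trans hs'.symm) hv hv'
  refine ⟨rfl, ?_⟩
  have := le_antisymm (sup_le_of_fastMatch hf hm he)
    (sup_le_of_fastMatch hf hm' fun i hi hc => (he i hi hc).symm)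
  simp only [Val.deps, this]

theorem prepared_unique (h : Sane faulty net) (hf : faulty.card ≤ f) {s : Slot f} {w : ℤ}
    {val val' : Val f Req} (hp : Prepared net w s val) (hp' : Prepared net w s val') :
    val = val' := by
  obtain ⟨P, hP, hm⟩ := hp
  obtain ⟨P', hP', hm'⟩ := hp'
  obtain ⟨i, hi, hi', hc⟩ := exists_correct_mem_inter hf hP hP'
  exact h.prepare_unique i hc _ _ _ _ (hm i hi) (hm' i hi')

theorem prepared_view (h : Sane faulty net) (hf : faulty.card ≤ f) {s : Slot f} {w : ℤ}
    {val : Val f Req} (hp : Prepared net w s val) : -1 ≤ w := by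
  obtain ⟨P, hP, hm⟩ := hp
  obtain ⟨i, hi, hc⟩ := exists_correct_of_card hf (Q := P) (by omega)
  exact h.prepare_view i hc _ _ _ (hm i hi)

theorem prepared_newView (h : Sane faulty net) (hf : faulty.card ≤ f) {s : Slot f} {w : ℤ}
    {val : Val f Req} (hw : 0 ≤ w) (hp : Prepared net w s val) :
    ∃ Q c, ValidNewView net s w val Q c := by
  obtain ⟨P, hP, hm⟩ := hp
  obtain ⟨i, hi, hc⟩ := exists_correct_of_card hf (Q := P) (by omega)
  exact h.prepare_newView i hc _ _ _ hw (hm i hi)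

/-- A prepared value is the no-op or a verified proposal. -/
theorem prepared_verified (h : Sane faulty net) (hf : faulty.card ≤ f) {s : Slot f} {w : ℤ}
    {val : Val f Req} (hp : Prepared net w s val) : val = .null ∨ VerifiedVal net s val := by
  rcases (h.prepared_view hf hp).eq_or_lt with rfl | hw
  · obtain ⟨P, hP, hm⟩ := hp
    obtain ⟨i, hi, hc⟩ := exists_correct_of_card hf (Q := P) (by omega)
    exact Or.inr (h.prepare_verified i hc _ _ (hm i hi))
  · obtain ⟨Q, c, -, hQ, hsel⟩ := h.prepared_newView hf (by omega) hp
    -- No induction on views is needed: a valid certificate carries the verification of its own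
    -- value.
    rcases hsel with ⟨i, hi, w', P', hci, -⟩ | ⟨-, i, hi, hci⟩ | ⟨-, rfl⟩
    · have := (hQ i hi).2
      rw [hci] at this
      exact this.2.2.2.2
    · have := (hQ i hi).2
      rw [hci] at this
      obtain ⟨dp, dv, h1, h2, h3, -⟩ := this
      exact Or.inr ⟨dp, dv, h1, h2, h3⟩
    · exact Or.inl rfl

theorem prepared_of_slowDecided (h : Sane faulty net) (hf : faulty.card ≤ f) {s : Slot f} {w : ℤ}
    {val : Val f Req} (hd : SlowDecided net w s val) : Prepared net w s val := by
  obtain ⟨Q, hQ, hm⟩ := hd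
  obtain ⟨i, hi, hc⟩ := exists_correct_of_card hf (Q := Q) (by omega)
  exact h.commit_prepared i hc _ _ _ (hm i hi)

/-- Once a value is decided on the reconciliation path, no other one is prepared later. -/
theorem prepared_of_le (h : Sane faulty net) (hf : faulty.card ≤ f) {s : Slot f} {w : ℤ}
    {val : Val f Req} (hd : SlowDecided net w s val) (n : ℕ) :
    ∀ (v : ℤ) (val' : Val f Req), v ≤ w + n → w ≤ v → Prepared net v s val' → val' = val := by
  have hw := h.prepared_view hf (h.prepared_of_slowDecided hf hd)
  induction n with
  | zero =>
    intro v val' h1 h2 hp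
    obtain rfl : v = w := by push_cast at h1; omega
    exact h.prepared_unique hf hp (h.prepared_of_slowDecided hf hd)
  | succ n ih =>
    intro v val' h1 h2 hp
    by_cases hlt : v ≤ w + n
    · exact ih v val' hlt h2 hp
    push_cast at h1
    obtain ⟨Q, c, hQ, hvc, hsel⟩ := h.prepared_newView hf (by omega) hp
    obtain ⟨Q', hQ', hm⟩ := hd
    obtain ⟨i, hi, hi', hc⟩ := exists_correct_mem_inter hf hQ hQ'
    -- A correct replica that signed a `Commit` in view `w` and a `ViewChange` for `v > w` reports a
    -- reconciliation certificate of view at least `w`. The selected certificate therefore has a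
    -- view in `[w, v)`, where the induction hypothesis applies.
    obtain ⟨w', val', P, hci, hww⟩ :=
      h.viewChange_slow i hc w v s val (c i) (hm i hi') (hvc i hi).1 (by omega)
    rcases hsel with ⟨j, hj, wj, Pj, hcj, hmax⟩ | ⟨hno, -⟩ | ⟨hno, -⟩
    · have hv := (hvc j hj).2
      rw [hcj] at hv
      have := hmax i hi _ _ _ hci
      exact ih wj _ (by have := hv.2.1; omega) (by omega) ⟨Pj, hv.2.2.1, hv.2.2.2.1⟩
    · exact absurd hci (hno i hi _ _ _)
    · rw [hno i hi] at hci; cases hci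

theorem fastDecided_fastVal (h : Sane faulty net) (hf : faulty.card ≤ f) {s : Slot f}
    {val : Val f Req} (hd : FastDecided net s val) : FastVal net s val := by
  obtain ⟨Q, hQ, hm⟩ := hd
  obtain ⟨i, hi, hc⟩ := exists_correct_of_card hf (Q := Q) (by omega)
  exact h.depCommit_fast i hc _ _ (hm i hi)

/-- Once a value is decided on the fast path, every prepared value agrees with it. -/
theorem prepared_of_fastDecided (h : Sane faulty net) (hf : faulty.card ≤ f) {s : Slot f}
    {val : Val f Req} (hd : FastDecided net s val) (n : ℕ) :
    ∀ (v : ℤ) (val' : Val f Req), v < n → Prepared net v s val' →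
      val'.req = val.req ∧ val'.deps = val.deps := by
  induction n with
  | zero =>
    intro v val' h1 hp
    -- Below view `0` only view `-1` remains, where no correct replica signs both a `Prepare` and a
    -- `DepCommit`.
    obtain rfl : v = -1 := by have := h.prepared_view hf hp; push_cast at h1; omega
    obtain ⟨P, hP, hm⟩ := hp
    obtain ⟨Q, hQ, hm'⟩ := hd
    obtain ⟨i, hi, hi', hc⟩ := exists_correct_mem_inter hf hP hQ
    exact absurd (hm i hi) (h.depCommit_prepare i hc _ _ _ (hm' i hi'))
  | succ n ih =>
    intro v val' h1 hp
    by_cases hlt : v < n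
    · exact ih v val' hlt hp
    push_cast at h1
    obtain ⟨Q, c, hQ, hvc, hsel⟩ := h.prepared_newView hf (by omega) hp
    have hfv := h.fastDecided_fastVal hf hd
    obtain ⟨Q', hQ', hm⟩ := hd
    obtain ⟨i, hi, hi', hc⟩ := exists_correct_mem_inter hf hQ hQ'
    -- This report rules out the no-op. A selected reconciliation certificate has a smaller view,
    -- and a selected fast-path certificate agrees by `fastVal_unique`.
    have hci := h.viewChange_fast i hc v s val (c i) (hm i hi') (hvc i hi).1
    rcases hsel with ⟨j, hj, wj, Pj, hcj, hmax⟩ | ⟨-, j, hj, hcj⟩ | ⟨hno, -⟩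
    · have hv := (hvc j hj).2
      rw [hcj] at hv
      exact ih wj _ (by have := hv.2.1; omega) ⟨Pj, hv.2.2.1, hv.2.2.2.1⟩
    · have hv := (hvc j hj).2
      rw [hcj] at hv
      exact h.fastVal_unique hf hv hfv
    · rw [hno i hi] at hci
      rcases hci with hci | ⟨_, _, _, hci⟩ <;> cases hci

theorem fast_slow_agree (h : Sane faulty net) (hf : faulty.card ≤ f) {s : Slot f}
    {val val' : Val f Req} {w : ℤ} (hd : FastDecided net s val) (hd' : SlowDecided net w s val') :
    val'.req = val.req ∧ val'.deps = val.deps :=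
  h.prepared_of_fastDecided hf hd (w + 1).toNat w val'
    (by have := Int.self_le_toNat (w + 1); omega) (h.prepared_of_slowDecided hf hd')

theorem slow_slow_agree (h : Sane faulty net) (hf : faulty.card ≤ f) {s : Slot f}
    {val val' : Val f Req} {w w' : ℤ} (hd : SlowDecided net w s val)
    (hd' : SlowDecided net w' s val') (hw : w ≤ w') : val' = val :=
  h.prepared_of_le hf hd (w' - w).toNat w' val'
    (by have := Int.self_le_toNat (w' - w); omega) hw (h.prepared_of_slowDecided hf hd')

/-- Agreement: at most one request and one set of dependencies are decided for a slot. -/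
theorem decided_unique (h : Sane faulty net) (hf : faulty.card ≤ f) {s : Slot f}
    {q q' : Option Req} {D D' : Deps f} (hd : Decided net s q D) (hd' : Decided net s q' D') :
    q = q' ∧ D = D' := by
  obtain ⟨val, rfl, rfl, hv⟩ := hd
  obtain ⟨val', rfl, rfl, hv'⟩ := hd'
  rcases hv with hv | ⟨w, hv⟩ <;> rcases hv' with hv' | ⟨w', hv'⟩
  · exact h.fastVal_unique hf (h.fastDecided_fastVal hf hv) (h.fastDecided_fastVal hf hv')
  · exact (h.fast_slow_agree hf hv hv').imp Eq.symm Eq.symm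
  · exact h.fast_slow_agree hf hv' hv
  · rcases le_total w w' with hw | hw
    · rw [h.slow_slow_agree hf hv hv' hw]; exact ⟨rfl, rfl⟩
    · rw [h.slow_slow_agree hf hv' hv hw]; exact ⟨rfl, rfl⟩

/-- A decided request stems from a verified proposal. -/
theorem decided_verified (h : Sane faulty net) (hf : faulty.card ≤ f) {s : Slot f} {a : Req}
    {D : Deps f} (hd : Decided net s (some a) D) :
    ∃ dp dv, dp.slot = s ∧ dp.req = a ∧ D = dp.deps ⊔ dp.quorum.sup dv ∧ Verified net dp dv := by
  obtain ⟨val, hq, rfl, hv⟩ := hd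
  have key : val = .null ∨ VerifiedVal net s val := by
    rcases hv with hv | ⟨w, hv⟩
    · obtain ⟨dp, dv, h1, h2, h3, -⟩ := h.fastDecided_fastVal hf hv
      exact Or.inr ⟨dp, dv, h1, h2, h3⟩
    · exact h.prepared_verified hf (h.prepared_of_slowDecided hf hv)
  rcases key with rfl | ⟨dp, dv, rfl, hs, hver⟩
  · cases hq
  · exact ⟨dp, dv, hs, (Option.some.inj hq).symm, rfl, hver⟩

end Sane

/-! ### The invariant of a single slot at a correct replica -/

/-- The slot that a message is about. -/
def Msg.slot : Msg f Req → Slot f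
  | .depPropose dp => dp.slot
  | .depVerify _ dp _ => dp.slot
  | .depCommit _ s _ => s
  | .prepare _ _ s _ => s
  | .commit _ _ s _ => s
  | .viewChange _ _ s _ => s
  | .newView _ s _ _ _ => s
  | .exec _ s _ _ => s

/-- The phases of view `-1` outside of the reconciliation path. -/
def Phase.Early (p : Phase) : Prop :=
  p = .fresh ∨ p = .proposed ∨ p = .fpVerified ∨ p = .fpCommitted

section Monotone

variable {net net' : Set (Msg f Req)} {s : Slot f} {val : Val f Req}

theorem Verified.mono (hn : net ⊆ net') {dp : DepPropose f Req} {dv : Rep f → Deps f}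
    (h : Verified net dp dv) : Verified net' dp dv :=
  ⟨h.1, hn h.2.1, fun i hi => hn (h.2.2 i hi)⟩

theorem VerifiedVal.mono (hn : net ⊆ net') (h : VerifiedVal net s val) : VerifiedVal net' s val := by
  obtain ⟨dp, dv, h1, h2, h3⟩ := h
  exact ⟨dp, dv, h1, h2, h3.mono hn⟩

theorem FastVal.mono (hn : net ⊆ net') (h : FastVal net s val) : FastVal net' s val := by
  obtain ⟨dp, dv, h1, h2, h3, h4⟩ := h
  exact ⟨dp, dv, h1, h2, h3.mono hn, h4⟩

theorem Prepared.mono (hn : net ⊆ net') {w : ℤ} (h : Prepared net w s val) :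
    Prepared net' w s val := by
  obtain ⟨P, h1, h2⟩ := h
  exact ⟨P, h1, fun i hi => hn (h2 i hi)⟩

theorem Decided.mono (hn : net ⊆ net') {q : Option Req} {D : Deps f} (h : Decided net s q D) :
    Decided net' s q D := by
  obtain ⟨val, h1, h2, ⟨Q, h3, h4⟩ | ⟨w, Q, h3, h4⟩⟩ := h
  · exact ⟨val, h1, h2, Or.inl ⟨Q, h3, fun i hi => hn (h4 i hi)⟩⟩
  · exact ⟨val, h1, h2, Or.inr ⟨w, Q, h3, fun i hi => hn (h4 i hi)⟩⟩

theorem ValidCert.mono (hn : net ⊆ net') {w : ℤ} {c : Cert f Req} (h : ValidCert net s w c) :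
    ValidCert net' s w c := by
  cases c with
  | none => trivial
  | fpc val => exact FastVal.mono hn h
  | rpc w' val P =>
    exact ⟨h.1, h.2.1, h.2.2.1, fun i hi => hn (h.2.2.2.1 i hi),
      h.2.2.2.2.imp id (VerifiedVal.mono hn)⟩

theorem ValidNewView.mono (hn : net ⊆ net') {w : ℤ} {Q : Finset (Rep f)} {c : Rep f → Cert f Req}
    (h : ValidNewView net s w val Q c) : ValidNewView net' s w val Q c :=
  ⟨h.1, fun i hi => ⟨hn (h.2.1 i hi).1, (h.2.1 i hi).2.mono hn⟩, h.2.2⟩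

end Monotone

/-- Invariant of the state `ss` of slot `s` at the correct replica `i`: the messages about `s` that
`i` has signed, all of them in `own`, fit to the state and are justified by the messages in `net`. -/
structure SlotInv (net own : Set (Msg f Req)) (i : Rep f) (s : Slot f) (ss : SlotState f Req) :
    Prop where
  view_ge : -1 ≤ ss.view
  view_early : ss.phase.Early → ss.view = -1
  view_viewChange : ss.phase = .viewChange → 0 ≤ ss.view
  dp_slot : ∀ dp, ss.dp = some dp → dp.slot = s
  propose : ∀ dp, dp.slot = s → s.co = i → Msg.depPropose dp ∈ own →
    ss.dp = some dp ∧ ss.phase ≠ .fresh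
  verify : ∀ dp D, dp.slot = s → Msg.depVerify i dp D ∈ own → ss.dp = some dp ∧ ss.phase ≠ .fresh
  verify_unique : ∀ dp D D', dp.slot = s → Msg.depVerify i dp D ∈ own →
    Msg.depVerify i dp D' ∈ own → D = D'
  depCommit : ∀ val, Msg.depCommit i s val ∈ own → FastVal net s val ∧
    ss.phase ≠ .fresh ∧ ss.phase ≠ .proposed ∧
    (ss.newCert = .fpc val ∨ ∃ w' val' P, ss.newCert = .rpc w' val' P)
  depCommit_prepare : ∀ val val', Msg.depCommit i s val ∈ own → Msg.prepare i (-1) s val' ∉ own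
  prepare : ∀ w val, Msg.prepare i w s val ∈ own → -1 ≤ w ∧ w ≤ ss.view ∧ ¬ ss.phase.Early ∧
    (w = ss.view → ss.phase ≠ .viewChange)
  prepare_verified : ∀ val, Msg.prepare i (-1) s val ∈ own → VerifiedVal net s val
  prepare_newView : ∀ w val, 0 ≤ w → Msg.prepare i w s val ∈ own →
    ∃ Q c, ValidNewView net s w val Q c
  prepare_unique : ∀ w val val', Msg.prepare i w s val ∈ own → Msg.prepare i w s val' ∈ own →
    val = val'
  commit : ∀ w val, Msg.commit i w s val ∈ own → Prepared net w s val ∧ w ≤ ss.view ∧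
    ¬ ss.phase.Early ∧ ∃ w' val' P, ss.newCert = .rpc w' val' P ∧ w ≤ w'
  viewChange : ∀ w c, Msg.viewChange i w s c ∈ own → 0 ≤ w ∧ w ≤ ss.view
  viewChange_fast : ∀ w c val, Msg.depCommit i s val ∈ own → Msg.viewChange i w s c ∈ own →
    c = .fpc val ∨ ∃ w' val' P, c = .rpc w' val' P
  viewChange_slow : ∀ w v c val, Msg.commit i w s val ∈ own → Msg.viewChange i v s c ∈ own →
    w < v → ∃ w' val' P, c = .rpc w' val' P ∧ w ≤ w'

namespace SlotInv

variable {net net' own own' : Set (Msg f Req)} {i : Rep f} {s : Slot f} {ss : SlotState f Req}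

theorem start : SlotInv (∅ : Set (Msg f Req)) ∅ i s ⟨-1, .fresh, none, .null, ∅, .none, none⟩ := by
  constructor <;> simp

theorem mono (h : SlotInv net own i s ss) (hn : net ⊆ net') : SlotInv net' own i s ss where
  __ := h
  depCommit val hm := (h.depCommit val hm).imp (FastVal.mono hn) id
  prepare_verified val hm := (h.prepare_verified val hm).mono hn
  prepare_newView w val hw hm := by
    obtain ⟨Q, c, hv⟩ := h.prepare_newView w val hw hm
    exact ⟨Q, c, hv.mono hn⟩
  commit w val hm := (h.commit w val hm).imp (Prepared.mono hn) id

/-- In `SlotInv`, `own` occurs only in hypotheses and `net` only in justifications. The two sets can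
therefore be varied separately: `mono` enlarges `net`, while here `own` may gain messages of other
signers or about other slots. -/
theorem frame (h : SlotInv net own i s ss)
    (ho : ∀ m ∈ own', m.sender = i → m.slot = s → m ∈ own) : SlotInv net own' i s ss where
  view_ge := h.view_ge
  view_early := h.view_early
  view_viewChange := h.view_viewChange
  dp_slot := h.dp_slot
  propose dp hs hc hm := h.propose dp hs hc (ho _ hm (by rw [← hc, ← hs]; rfl) hs)
  verify dp D hs hm := h.verify dp D hs (ho _ hm rfl hs)
  verify_unique dp D D' hs hm hm' := h.verify_unique dp D D' hs (ho _ hm rfl hs) (ho _ hm' rfl hs)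
  depCommit val hm := h.depCommit val (ho _ hm rfl rfl)
  depCommit_prepare val val' hm hm' :=
    h.depCommit_prepare val val' (ho _ hm rfl rfl) (ho _ hm' rfl rfl)
  prepare w val hm := h.prepare w val (ho _ hm rfl rfl)
  prepare_verified val hm := h.prepare_verified val (ho _ hm rfl rfl)
  prepare_newView w val hw hm := h.prepare_newView w val hw (ho _ hm rfl rfl)
  prepare_unique w val val' hm hm' :=
    h.prepare_unique w val val' (ho _ hm rfl rfl) (ho _ hm' rfl rfl)
  commit w val hm := h.commit w val (ho _ hm rfl rfl)
  viewChange w c hm := h.viewChange w c (ho _ hm rfl rfl)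
  viewChange_fast w c val hm hm' := h.viewChange_fast w c val (ho _ hm rfl rfl) (ho _ hm' rfl rfl)
  viewChange_slow w v c val hm hm' :=
    h.viewChange_slow w v c val (ho _ hm rfl rfl) (ho _ hm' rfl rfl)

/-- Early phases have view `-1`, while a signed `ViewChange` forces a nonnegative view. -/
theorem not_early (h : SlotInv net own i s ss) (hp : ss.phase.Early) :
    (∀ w val, Msg.prepare i w s val ∉ own) ∧ (∀ w val, Msg.commit i w s val ∉ own) ∧
      ∀ w c, Msg.viewChange i w s c ∉ own := by
  refine ⟨fun w val hm => (h.prepare w val hm).2.2.1 hp,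
    fun w val hm => (h.commit w val hm).2.2.1 hp, fun w c hm => ?_⟩
  have := h.viewChange w c hm
  have := h.view_early hp
  omega

theorem propose_step (h : SlotInv net own i s ss) {dp : DepPropose f Req} (hs : dp.slot = s)
    (hp : ss.phase = .fresh) :
    SlotInv net (own ∪ {.depPropose dp}) i s { ss with phase := .proposed, dp := some dp } := by
  have hne := h.not_early (Or.inl hp)
  cases h
  constructor <;>
    simp only [Set.mem_union, Set.mem_singleton_iff, reduceCtorEq, or_false, SlotState.newCert,
      Phase.Early, Msg.depPropose.injEq] at * <;> grind

theorem accept_step (h : SlotInv net own i s ss) {dp : DepPropose f Req} {D : Deps f}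
    (hs : dp.slot = s) (hp : ss.phase = .fresh) :
    SlotInv net (own ∪ {m | i ∈ dp.quorum ∧ m = .depVerify i dp D}) i s
      { ss with phase := .proposed, dp := some dp } := by
  have hne := h.not_early (Or.inl hp)
  cases h
  constructor <;>
    simp only [Set.mem_union, Set.mem_ofPred_eq, reduceCtorEq, and_false, or_false,
      SlotState.newCert, Phase.Early, Msg.depVerify.injEq] at * <;> grind

theorem fpVerify_step (h : SlotInv net own i s ss) {val : Val f Req} (hp : ss.phase = .proposed)
    (hv : FastVal net s val) :
    SlotInv net (own ∪ {.depCommit i s val}) i s { ss with phase := .fpVerified, val := val } := by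
  have hne := h.not_early (Or.inr (Or.inl hp))
  cases h
  constructor <;>
    simp only [Set.mem_union, Set.mem_singleton_iff, reduceCtorEq, or_false, SlotState.newCert,
      Phase.Early, Msg.depCommit.injEq] at * <;> grind

theorem rpVerify_step (h : SlotInv net own i s ss) {val : Val f Req} (hp : ss.phase = .proposed)
    (hv : VerifiedVal net s val) :
    SlotInv net (own ∪ {.prepare i ss.view s val}) i s
      { ss with phase := .rpVerified, val := val } := by
  have hne := h.not_early (Or.inr (Or.inl hp))
  have hview := h.view_early (Or.inr (Or.inl hp))
  cases h
  constructor <;>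
    simp only [Set.mem_union, Set.mem_singleton_iff, reduceCtorEq, or_false, SlotState.newCert,
      Phase.Early, Msg.prepare.injEq] at * <;> grind

theorem fpCommit_step (h : SlotInv net own i s ss) {com : Option (Option Req × Deps f)}
    (hp : ss.phase = .fpVerified) :
    SlotInv net own i s { ss with phase := .fpCommitted, committed := com } := by
  cases h
  constructor <;> simp only [SlotState.newCert, Phase.Early] at * <;> grind

/-- The new certificate has the current view, and no earlier `Commit` has a larger one, so the
certificate covers them all. -/
theorem rpPrepare_step (h : SlotInv net own i s ss) {Q : Finset (Rep f)}
    (hp : ss.phase = .rpVerified) (hQ : Prepared net ss.view s ss.val) :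
    SlotInv net (own ∪ {.commit i ss.view s ss.val}) i s
      { ss with phase := .rpPrepared, preps := Q } := by
  cases h
  constructor <;>
    simp only [Set.mem_union, Set.mem_singleton_iff, reduceCtorEq, or_false, SlotState.newCert,
      Phase.Early, Msg.commit.injEq] at * <;> grind

theorem rpCommit_step (h : SlotInv net own i s ss) {com : Option (Option Req × Deps f)}
    (hp : ss.phase = .rpPrepared) :
    SlotInv net own i s { ss with phase := .rpCommitted, committed := com } := by
  cases h
  constructor <;> simp only [SlotState.newCert, Phase.Early] at * <;> grind

/-- Leaving a view freezes the certificate, so what is known about `newCert` persists. -/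
theorem newCert_viewChange (ss : SlotState f Req) (view : ℤ) :
    ({ ss with view := view, phase := .viewChange, cert := ss.newCert } :
      SlotState f Req).newCert = ss.newCert := rfl

theorem startViewChange_step (h : SlotInv net own i s ss) {view : ℤ} (hv : ss.view < view) :
    SlotInv net (own ∪ {.viewChange i view s ss.newCert}) i s
      { ss with view := view, phase := .viewChange, cert := ss.newCert } := by
  cases h
  constructor <;>
    simp only [Set.mem_union, Set.mem_singleton_iff, reduceCtorEq, or_false, newCert_viewChange,
      Phase.Early, Msg.viewChange.injEq] at * <;> grind

/-- Phase `viewChange` excludes an earlier `Prepare` in the current view, and the view is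
nonnegative, so the new `Prepare` cannot clash with a `DepCommit`. -/
theorem acceptNewView_step (h : SlotInv net own i s ss) {val : Val f Req} {Q : Finset (Rep f)}
    {c : Rep f → Cert f Req} (hp : ss.phase = .viewChange)
    (hv : ValidNewView net s ss.view val Q c) :
    SlotInv net (own ∪ {.prepare i ss.view s val}) i s
      { ss with phase := .rpVerified, val := val } := by
  cases h
  constructor <;>
    simp only [Set.mem_union, Set.mem_singleton_iff, reduceCtorEq, or_false, SlotState.newCert,
      Phase.Early, Msg.prepare.injEq] at * <;> grind

theorem committed_step (h : SlotInv net own i s ss) (com : Option (Option Req × Deps f)) :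
    SlotInv net own i s { ss with committed := com } := by
  cases h
  constructor <;> simpa only [SlotState.newCert]

/-- Nothing is required of a signed `newView`, because its receivers check `ValidNewView`
themselves. -/
theorem union_newView (h : SlotInv net own i s ss) {w : ℤ} {t : Slot f} {val : Val f Req}
    {Q : Finset (Rep f)} {c : Rep f → Cert f Req} :
    SlotInv net (own ∪ {.newView w t val Q c}) i s ss := by
  cases h
  constructor <;>
    simpa only [Set.mem_union, Set.mem_singleton_iff, reduceCtorEq, or_false]

theorem union_exec (h : SlotInv net own i s ss) {j : Rep f} {t : Slot f} {q : Option Req}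
    {D : Deps f} : SlotInv net (own ∪ {.exec j t q D}) i s ss := by
  cases h
  constructor <;>
    simpa only [Set.mem_union, Set.mem_singleton_iff, reduceCtorEq, or_false]

end SlotInv

/-! ### Dependencies between conflicting proposals -/

/-- Replica `i` has proposed `dp`, or accepted it as a member of its fast-path quorum, and has
announced the dependencies `D` for it. -/
def Handled (net : Set (Msg f Req)) (i : Rep f) (dp : DepPropose f Req) (D : Deps f) : Prop :=
  (dp.slot.co = i ∧ D = dp.deps ∧ Msg.depPropose dp ∈ net) ∨ Msg.depVerify i dp D ∈ net

/-- The coordinator counts as a witness besides its `2 f` followers, which yields a quorum of `2 f +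
1`. -/
theorem Verified.exists_handled {net : Set (Msg f Req)} {dp : DepPropose f Req}
    {dv : Rep f → Deps f} (hv : Verified net dp dv) {r : Rep f}
    (hr : r ∈ insert dp.slot.co dp.quorum) :
    ∃ D ≤ dp.deps ⊔ dp.quorum.sup dv, Handled net r dp D := by
  rcases Finset.mem_insert.1 hr with rfl | hr
  · exact ⟨dp.deps, le_sup_left, Or.inl ⟨rfl, rfl, hv.2.1⟩⟩
  · exact ⟨dv r, le_sup_of_le_right (Finset.le_sup hr), Or.inr (hv.2.2 r hr)⟩

/-- A correct replica knows all proposals that it has handled, and among two conflicting ones the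
later has a dependency on the earlier. -/
structure KnownInv (conflict : Req → Req → Prop) (net : Set (Msg f Req)) (i : Rep f)
    (known : Set (Slot f × Req)) : Prop where
  known : ∀ dp D, Handled net i dp D → (dp.slot, dp.req) ∈ known
  dep : ∀ dp dp' D D', Handled net i dp D → Handled net i dp' D' → dp.slot ≠ dp'.slot →
    conflict dp.req dp'.req → D.Has dp'.slot ∨ D'.Has dp.slot

theorem Local.IsConflicts.has {conflict : Req → Req → Prop} {L : Local f Req} {r r' : Req}
    {D : Deps f} (h : L.IsConflicts conflict r D) {s : Slot f} (hk : (s, r') ∈ L.known)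
    (hc : conflict r r') : D.Has s :=
  (h s.co).1 ⟨s.seq, r', rfl, hk, hc⟩

namespace KnownInv

variable {conflict : Req → Req → Prop} {net net' : Set (Msg f Req)} {i : Rep f}
  {known known' : Set (Slot f × Req)}

theorem frame (h : KnownInv conflict net i known) (hk : known ⊆ known')
    (hn : ∀ dp D, Handled net' i dp D → Handled net i dp D) : KnownInv conflict net' i known' where
  known dp D hd := hk (h.known dp D (hn dp D hd))
  dep dp dp' D D' hd hd' := h.dep dp dp' D D' (hn _ _ hd) (hn _ _ hd')

/-- The proposal handled last computes its dependencies while all earlier ones are already known.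
Symmetry of `conflict` covers the case where the new proposal is the second argument. -/
theorem handle (conflict_symm : ∀ a b, conflict a b → conflict b a) {L : Local f Req}
    (h : KnownInv conflict net i L.known) {dp : DepPropose f Req} {D : Deps f}
    (hc : L.IsConflicts conflict dp.req D)
    (hn : ∀ dp' D', Handled net' i dp' D' → Handled net i dp' D' ∨ dp' = dp ∧ D' = D) :
    KnownInv conflict net' i (L.learn dp.slot (some dp.req)).known where
  known dp' D' hd := by
    rcases hn _ _ hd with hd | ⟨rfl, rfl⟩
    · exact Or.inl (h.known _ _ hd)
    · exact Or.inr ⟨rfl, rfl⟩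
  dep dp₁ dp₂ D₁ D₂ hd₁ hd₂ hne hcon := by
    rcases hn _ _ hd₁ with hd₁ | ⟨rfl, rfl⟩ <;> rcases hn _ _ hd₂ with hd₂ | ⟨rfl, rfl⟩
    · exact h.dep _ _ _ _ hd₁ hd₂ hne hcon
    · exact Or.inr (hc.has (h.known _ _ hd₁) (conflict_symm _ _ hcon))
    · exact Or.inl (hc.has (h.known _ _ hd₂) hcon)
    · exact absurd rfl hne

end KnownInv

/-! ### Preservation of the agreement invariants -/

/-- Invariant of the agreement state of a correct replica. -/
structure ReplicaInv (conflict : Req → Req → Prop) (net : Set (Msg f Req)) (i : Rep f)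
    (L : Local f Req) : Prop where
  slot : ∀ s, SlotInv net net i s (L.slots s)
  known : KnownInv conflict net i L.known

theorem LocalStep.sender_eq [LinearOrder (Slot f)] {conflict : Req → Req → Prop} {k : ℕ} {i : Rep f}
    {net out : Set (Msg f Req)} {L L' : Local f Req} (hs : LocalStep conflict k i net L L' out)
    {m : Msg f Req} (hm : m ∈ out) : m.sender = i := by
  cases hs
  case accept => rw [hm.2]; rfl
  case propose h _ _ _ _ => rw [hm]; exact h
  case sendNewView h _ => rw [hm]; exact h
  all_goals first
    | exact hm.elim
    | (rw [hm]; rfl)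

theorem LocalStep.exec_mem [LinearOrder (Slot f)] {conflict : Req → Req → Prop} {k : ℕ} {i j : Rep f}
    {net out : Set (Msg f Req)} {L L' : Local f Req} (hs : LocalStep conflict k i net L L' out)
    {s : Slot f} {q : Option Req} {D : Deps f} (hm : Msg.exec j s q D ∈ out) :
    (L.slots s).committed = some (q, D) := by
  cases hs <;> simp_all

theorem LocalStep.committed_eq [LinearOrder (Slot f)] {conflict : Req → Req → Prop} {k : ℕ}
    {i : Rep f} {net out : Set (Msg f Req)} {L L' : Local f Req}
    (hs : LocalStep conflict k i net L L' out) {s : Slot f} {q : Option Req} {D : Deps f}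
    (hc : (L'.slots s).committed = some (q, D)) :
    (L.slots s).committed = some (q, D) ∨ Decided net s q D ∨
      ∃ Q : Finset (Rep f), Q.card = f + 1 ∧ ∀ j ∈ Q, Msg.exec j s q D ∈ net := by
  cases hs
  case sendNewView | sendExec | execNormal | execUnblock => exact Or.inl hc
  case fpCommit t Q hp hQ hm =>
    by_cases hst : s = t
    · subst hst
      simp only [Local.setSlot, Function.update_self, Option.some.injEq, Prod.mk.injEq] at hc
      exact Or.inr (Or.inl ⟨_, hc.1.symm, hc.2.symm, Or.inl ⟨Q, hQ, hm⟩⟩)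
    · simp only [Local.setSlot, Function.update_of_ne hst] at hc
      exact Or.inl hc
  case rpCommit t Q hp hQ hm =>
    by_cases hst : s = t
    · subst hst
      simp only [Local.setSlot, Function.update_self, Option.some.injEq, Prod.mk.injEq] at hc
      exact Or.inr (Or.inl ⟨_, hc.1.symm, hc.2.symm, Or.inr ⟨_, Q, hQ, hm⟩⟩)
    · simp only [Local.setSlot, Function.update_of_ne hst] at hc
      exact Or.inl hc
  case learnExec t q D Q hQ hm =>
    by_cases hst : s = t
    · subst hst
      simp only [Local.setSlot, Local.learn, Function.update_self, Option.some.injEq,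
        Prod.mk.injEq] at hc
      obtain ⟨rfl, rfl⟩ := hc
      exact Or.inr (Or.inr ⟨Q, hQ, hm⟩)
    · simp only [Local.setSlot, Local.learn, Function.update_of_ne hst] at hc
      exact Or.inl hc
  all_goals
    simp only [Local.setSlot, Local.learn, Function.update_apply] at hc
    split_ifs at hc with hst
    · subst hst; exact Or.inl hc
    · exact Or.inl hc

/-- A slot may be committed repeatedly, for instance by catch-up and later on a path. That the new
value equals the old one is not a local fact; it follows from `Sane.decided_unique`. -/
theorem LocalStep.committed_isSome [LinearOrder (Slot f)] {conflict : Req → Req → Prop} {k : ℕ}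
    {i : Rep f} {net out : Set (Msg f Req)} {L L' : Local f Req}
    (hs : LocalStep conflict k i net L L' out) {s : Slot f}
    (hc : (L.slots s).committed.isSome) : (L'.slots s).committed.isSome := by
  cases hs <;> first
    | exact hc
    | (simp only [Local.setSlot, Local.learn, Function.update_apply]
       split_ifs with hst
       · subst hst; first | exact hc | rfl
       · exact hc)

namespace ReplicaInv

variable {conflict : Req → Req → Prop} {net net' : Set (Msg f Req)} {i : Rep f} {L : Local f Req}

theorem frame (h : ReplicaInv conflict net i L) (hn : net ⊆ net')
    (ho : ∀ m ∈ net', m.sender = i → m ∈ net) : ReplicaInv conflict net' i L where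
  slot s := ((h.slot s).mono hn).frame fun m hm hi _ => ho m hm hi
  known := h.known.frame subset_rfl fun _ _ hd => hd.imp
    (fun hd => ⟨hd.1, hd.2.1, ho _ hd.2.2 hd.1⟩) fun hd => ho _ hd rfl

theorem setSlot_inv (h : ReplicaInv conflict net i L) {out : Set (Msg f Req)} {s : Slot f}
    {ss : SlotState f Req} (ho : ∀ m ∈ out, m.slot = s)
    (hs : SlotInv (net ∪ out) (net ∪ out) i s ss) (t : Slot f) :
    SlotInv (net ∪ out) (net ∪ out) i t ((L.setSlot s ss).slots t) := by
  by_cases hst : t = s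
  · subst hst
    simpa only [Local.setSlot, Function.update_self] using hs
  · simp only [Local.setSlot, Function.update_of_ne hst]
    refine ((h.slot t).mono Set.subset_union_left).frame fun m hm _ ht => ?_
    rcases hm with hm | hm
    · exact hm
    · exact absurd (ht.symm.trans (ho m hm)) hst

theorem known_inv (h : ReplicaInv conflict net i L) {out : Set (Msg f Req)}
    {known : Set (Slot f × Req)} (hk : L.known ⊆ known)
    (h1 : ∀ dp, Msg.depPropose dp ∉ out) (h2 : ∀ j dp D, Msg.depVerify j dp D ∉ out) :
    KnownInv conflict (net ∪ out) i known :=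
  h.known.frame hk fun _ _ hd => hd.imp
    (fun hd => ⟨hd.1, hd.2.1, hd.2.2.resolve_right (h1 _)⟩) fun hd => hd.resolve_right (h2 _ _ _)

theorem step [LinearOrder (Slot f)] (conflict_symm : ∀ a b, conflict a b → conflict b a) {k : ℕ}
    {L' : Local f Req} {out : Set (Msg f Req)} (h : ReplicaInv conflict net i L)
    (hs : LocalStep conflict k i net L L' out) : ReplicaInv conflict (net ∪ out) i L' := by
  have hmono (s : Slot f) : SlotInv (net ∪ out) net i s (L.slots s) :=
    (h.slot s).mono Set.subset_union_left
  have hsub : net ⊆ net ∪ out := Set.subset_union_left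
  cases hs
  case propose dp hco hp hlow hq hc =>
    refine ⟨h.setSlot_inv (by rintro m rfl; rfl) ((hmono _).propose_step rfl hp), ?_⟩
    refine h.known.handle conflict_symm hc fun dp' D' hd => ?_
    simp only [Handled, Set.mem_union, Set.mem_singleton_iff, reduceCtorEq, or_false,
      Msg.depPropose.injEq] at hd ⊢
    grind
  case accept dp D hm hco hp hq hc =>
    refine ⟨h.setSlot_inv (by rintro m ⟨-, rfl⟩; rfl) ((hmono _).accept_step rfl hp), ?_⟩
    refine h.known.handle conflict_symm hc fun dp' D' hd => ?_
    simp only [Handled, Set.mem_union, Set.mem_ofPred_eq, reduceCtorEq, and_false, or_false,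
      Msg.depVerify.injEq] at hd ⊢
    grind
  case fpVerify s dp dv hp hdp hv hm =>
    exact ⟨h.setSlot_inv (by rintro m rfl; rfl) ((hmono _).fpVerify_step hp
      (FastVal.mono hsub ⟨dp, dv, rfl, (h.slot s).dp_slot _ hdp, hv, hm⟩)),
      h.known_inv subset_rfl (by simp) (by simp)⟩
  case rpVerify s dp dv hp hdp hv hm =>
    exact ⟨h.setSlot_inv (by rintro m rfl; rfl) ((hmono _).rpVerify_step hp
      (VerifiedVal.mono hsub ⟨dp, dv, rfl, (h.slot s).dp_slot _ hdp, hv⟩)),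
      h.known_inv subset_rfl (by simp) (by simp)⟩
  case fpCommit s Q hp hQ hm =>
    exact ⟨h.setSlot_inv (by simp) (by simpa using (h.slot s).fpCommit_step hp),
      h.known_inv subset_rfl (by simp) (by simp)⟩
  case rpPrepare s Q hp hQ hm =>
    exact ⟨h.setSlot_inv (by rintro m rfl; rfl) ((hmono _).rpPrepare_step hp
      (Prepared.mono hsub ⟨Q, hQ, hm⟩)), h.known_inv subset_rfl (by simp) (by simp)⟩
  case rpCommit s Q hp hQ hm =>
    exact ⟨h.setSlot_inv (by simp) (by simpa using (h.slot s).rpCommit_step hp),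
      h.known_inv subset_rfl (by simp) (by simp)⟩
  case startViewChange s view hv =>
    exact ⟨h.setSlot_inv (by rintro m rfl; rfl) ((hmono _).startViewChange_step hv),
      h.known_inv subset_rfl (by simp) (by simp)⟩
  case sendNewView s val Q c hp hco hv =>
    exact ⟨fun t => (hmono t).union_newView, h.known_inv subset_rfl (by simp) (by simp)⟩
  case acceptNewView s val Q c hp hm hv =>
    exact ⟨h.setSlot_inv (by rintro m rfl; rfl) ((hmono _).acceptNewView_step hp (hv.mono hsub)),
      h.known_inv Set.subset_union_left (by simp) (by simp)⟩
  case sendExec s q D hc =>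
    exact ⟨fun t => (hmono t).union_exec, h.known_inv subset_rfl (by simp) (by simp)⟩
  case learnExec s q D Q hQ hm =>
    exact ⟨h.setSlot_inv (by simp) (by simpa using (h.slot s).committed_step _),
      h.known_inv Set.subset_union_left (by simp) (by simp)⟩
  case execNormal =>
    exact ⟨fun t => by simpa [Local.run] using h.slot t, h.known_inv subset_rfl (by simp) (by simp)⟩
  case execUnblock =>
    exact ⟨fun t => by simpa [Local.run] using h.slot t, h.known_inv subset_rfl (by simp) (by simp)⟩

end ReplicaInv

/-- Invariant of the agreement in all correct replicas. -/
structure AgreeInv (conflict : Req → Req → Prop) (faulty : Finset (Rep f)) (σ : State f Req) :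
    Prop where
  replica : ∀ i ∉ faulty, ReplicaInv conflict σ.net i (σ.loc i)
  committed : ∀ i ∉ faulty, ∀ s q D, ((σ.loc i).slots s).committed = some (q, D) →
    Decided σ.net s q D
  exec : ∀ i ∉ faulty, ∀ s q D, Msg.exec i s q D ∈ σ.net → Decided σ.net s q D

namespace AgreeInv

variable {conflict : Req → Req → Prop} {faulty : Finset (Rep f)} {σ σ' : State f Req}

theorem start : AgreeInv conflict faulty (State.start f Req) where
  replica i _ := ⟨fun s => SlotInv.start, by constructor <;> simp [Handled, State.start]⟩
  committed := by simp [State.start]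
  exec := by simp [State.start]

theorem step [LinearOrder (Slot f)] (conflict_symm : ∀ a b, conflict a b → conflict b a) {k : ℕ}
    (hf : faulty.card ≤ f) (h : AgreeInv conflict faulty σ)
    (hs : Step conflict k faulty σ σ') : AgreeInv conflict faulty σ' := by
  cases hs with
  | correct i L' out hi hl =>
    have hsub : σ.net ⊆ σ.net ∪ out := Set.subset_union_left
    refine ⟨fun j hj => ?_, fun j hj s q D hc => ?_, fun j hj s q D hm => ?_⟩
    · by_cases hji : j = i
      · subst hji
        simpa using (h.replica j hj).step conflict_symm hl
      · simp only [Function.update_of_ne hji]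
        refine (h.replica j hj).frame hsub fun m hm hmj => ?_
        rcases hm with hm | hm
        · exact hm
        · exact absurd (hmj.symm.trans (hl.sender_eq hm)) hji
    · by_cases hji : j = i
      · subst hji
        simp only [Function.update_self] at hc
        rcases hl.committed_eq hc with hc | hd | ⟨Q, hQ, hm⟩
        · exact (h.committed j hj s q D hc).mono hsub
        · exact hd.mono hsub
        · obtain ⟨l, hl, hc⟩ := exists_correct_of_card hf hQ.ge
          exact (h.exec l hc s q D (hm l hl)).mono hsub
      · simp only [Function.update_of_ne hji] at hc
        exact (h.committed j hj s q D hc).mono hsub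
    · rcases hm with hm | hm
      · exact (h.exec j hj s q D hm).mono hsub
      · exact (h.committed i hi s q D (hl.exec_mem hm)).mono hsub
  | byzantine m hm =>
    have hsub : σ.net ⊆ insert m σ.net := Set.subset_insert _ _
    refine ⟨fun j hj => ?_, fun j hj s q D hc => ?_, fun j hj s q D hm' => ?_⟩
    · refine (h.replica j hj).frame hsub fun m' hm' hmj => ?_
      rcases hm' with rfl | hm'
      · exact absurd (hmj ▸ hm) hj
      · exact hm'
    · exact (h.committed j hj s q D hc).mono hsub
    · rcases hm' with rfl | hm'
      · exact absurd hm hj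
      · exact (h.exec j hj s q D hm').mono hsub

theorem sane (h : AgreeInv conflict faulty σ) : Sane faulty σ.net where
  propose_unique dp dp' hc hs hm hm' := by
    have h1 := ((h.replica _ hc).slot dp.slot).propose dp rfl rfl hm
    have h2 := ((h.replica _ hc).slot dp.slot).propose dp' hs.symm rfl hm'
    exact Option.some.inj (h1.1.symm.trans h2.1)
  verify_unique i hi dp dp' D D' hs hm hm' := by
    have h1 := ((h.replica _ hi).slot dp.slot).verify dp D rfl hm
    have h2 := ((h.replica _ hi).slot dp.slot).verify dp' D' hs.symm hm'
    obtain rfl := Option.some.inj (h1.1.symm.trans h2.1)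
    exact ⟨rfl, ((h.replica _ hi).slot dp.slot).verify_unique dp D D' rfl hm hm'⟩
  depCommit_fast i hi s val hm := (((h.replica i hi).slot s).depCommit val hm).1
  depCommit_prepare i hi s := ((h.replica i hi).slot s).depCommit_prepare
  prepare_unique i hi w s := ((h.replica i hi).slot s).prepare_unique w
  prepare_view i hi w s val hm := (((h.replica i hi).slot s).prepare w val hm).1
  prepare_verified i hi s := ((h.replica i hi).slot s).prepare_verified
  prepare_newView i hi w s := ((h.replica i hi).slot s).prepare_newView w
  commit_prepared i hi w s val hm := (((h.replica i hi).slot s).commit w val hm).1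
  viewChange_fast i hi w s val c := ((h.replica i hi).slot s).viewChange_fast w c val
  viewChange_slow i hi w v s val c := ((h.replica i hi).slot s).viewChange_slow w v c val

/-- Correct replicas commit the same request with the same dependencies for a slot. -/
theorem committed_unique (h : AgreeInv conflict faulty σ) (hf : faulty.card ≤ f) {i j : Rep f}
    (hi : i ∉ faulty) (hj : j ∉ faulty) {s : Slot f} {x y : Option Req × Deps f}
    (hx : ((σ.loc i).slots s).committed = some x) (hy : ((σ.loc j).slots s).committed = some y) :
    x = y :=
  Prod.ext_iff.2 (h.sane.decided_unique hf (h.committed i hi _ _ _ hx) (h.committed j hj _ _ _ hy))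

/-- Committed conflicting requests are connected by a dependency. -/
theorem has_or_has (h : AgreeInv conflict faulty σ) (hf : faulty.card ≤ f) {i j : Rep f}
    (hi : i ∉ faulty) (hj : j ∉ faulty) {u v : Slot f} {a b : Req} {D D' : Deps f} (huv : u ≠ v)
    (hu : σ.Committed i u a D) (hv : σ.Committed j v b D') (hc : conflict a b) :
    D.Has v ∨ D'.Has u := by
  obtain ⟨dp, dv, rfl, rfl, rfl, hver⟩ := h.sane.decided_verified hf (h.committed i hi _ _ _ hu)
  obtain ⟨dp', dv', rfl, rfl, rfl, hver'⟩ := h.sane.decided_verified hf (h.committed j hj _ _ _ hv)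
  -- The replica `r` took part in both verifications, and what it announced is contained in the
  -- committed unions.
  obtain ⟨r, hr, hr', hcor⟩ := exists_correct_mem_inter hf
    (Q := insert dp.slot.co dp.quorum) (Q' := insert dp'.slot.co dp'.quorum)
    (by rw [Finset.card_insert_of_notMem hver.1.2, hver.1.1])
    (by rw [Finset.card_insert_of_notMem hver'.1.2, hver'.1.1])
  obtain ⟨D₁, hle₁, hd₁⟩ := hver.exists_handled hr
  obtain ⟨D₂, hle₂, hd₂⟩ := hver'.exists_handled hr'
  exact ((h.replica r hcor).known.dep _ _ _ _ hd₁ hd₂ huv hc).imp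
    (fun hh => le_trans hh (hle₁ _)) (fun hh => le_trans hh (hle₂ _))

end AgreeInv

/-! ### Blocks executed at two replicas -/

namespace Local

variable {L : Local f Req} {k : ℕ}

/-- The log is finite, so the set whose infimum defines `exp` is nonempty and the default value of
`sInf` plays no role. -/
theorem exp_notMem_log (L : Local f Req) (l : Rep f) : (⟨l, L.exp l⟩ : Slot f) ∉ L.log := by
  have hne : {n | (⟨l, n⟩ : Slot f) ∉ L.log}.Nonempty := by
    by_contra! h
    have hall (n : ℕ) : (⟨l, n⟩ : Slot f) ∈ L.log := by
      by_contra hn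
      exact (h ▸ (show n ∈ {n | (⟨l, n⟩ : Slot f) ∉ L.log} from hn) : n ∈ (∅ : Set ℕ))
    have hinj : Function.Injective fun n => (⟨l, n⟩ : Slot f) := fun a b hab => by
      simpa using hab
    exact Set.infinite_range_of_injective hinj
      ((List.finite_toSet L.log).subset (by rintro _ ⟨n, rfl⟩; exact hall n))
  exact Nat.sInf_mem hne

theorem mem_log_of_lt_exp {l : Rep f} {n : ℕ} (h : n < L.exp l) : (⟨l, n⟩ : Slot f) ∈ L.log :=
  not_not.1 (Nat.notMem_of_lt_sInf h)

theorem DependsOn.of_le {u d : Slot f} (h : L.DependsOn u d) {n : ℕ} (hn : n ≤ d.seq) :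
    L.DependsOn u ⟨d.co, n⟩ := by
  obtain ⟨q, D, hc, hD⟩ := h
  exact ⟨q, D, hc, le_trans (by simpa using hn) hD⟩

/-- The recorded dependency graphs consist of executed slots only. -/
def RhistClosed (L : Local f Req) : Prop :=
  ∀ v g, L.rhist v = some g → v ∈ L.log ∧ (∀ d ∈ g.nodes, d ∈ L.log) ∧
    ∀ e ∈ g.edges, e.1 ∈ L.log ∧ e.2 ∈ L.log

/-- The slots in `vs` can be executed next as a strongly connected component of the dependency
graph that is restricted to the execution window. -/
structure Block [LinearOrder (Slot f)] (L : Local f Req) (k : ℕ) (vs : List (Slot f)) : Prop where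
  sorted : vs.Pairwise (· < ·)
  fresh : ∀ u ∈ vs, u ∉ L.log
  committed : ∀ u ∈ vs, u ∈ L.committedSet
  window : ∀ u ∈ vs, u ∈ L.window k
  closed : ∀ u ∈ vs, ∀ d, L.DependsOn u d → d ∈ L.window k → d ∈ vs ∨ d ∈ L.log
  connected : ∀ A : Set (Slot f), (∃ x ∈ vs, x ∈ A) →
    (∀ a ∈ vs, a ∈ A → ∀ d ∈ vs, L.DependsOn a d → d ∈ L.window k → d ∈ A) → ∀ x ∈ vs, x ∈ A

/-- The state after the execution of `vs`. -/
def execBlock (L : Local f Req) (k : ℕ) (vs : List (Slot f)) : Local f Req :=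
  L.run vs (L.rdepsExp k {s | s ∈ vs})

/-- No slot is committed differently in the two states. -/
def Compatible (L L' : Local f Req) : Prop :=
  ∀ s x y, (L.slots s).committed = some x → (L'.slots s).committed = some y → x = y

theorem Compatible.symm {L L' : Local f Req} (h : Compatible L L') : Compatible L' L :=
  fun s x y hx hy => (h s y x hy hx).symm

theorem DependsOn.transfer {L L' : Local f Req} (h : Compatible L L') {u d : Slot f}
    (hd : L.DependsOn u d) (hu : u ∈ L'.committedSet) : L'.DependsOn u d := by
  obtain ⟨q, D, hc, hD⟩ := hd
  obtain ⟨y, hy⟩ := Option.isSome_iff_exists.1 hu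
  obtain rfl := h _ _ _ hc hy
  exact ⟨q, D, hy, hD⟩

theorem InGraph.mono_roots {W R R' : Set (Slot f)} (hR : ∀ r ∈ R, L.InGraph W R' r) {d : Slot f}
    (h : L.InGraph W R d) : L.InGraph W R' d := by
  induction h with
  | root hv _ => exact hR _ hv
  | dep _ hu hd hW ih => exact ih.dep hu hd hW
  | hist _ hr hd ih => exact ih.hist hr hd

theorem InGraph.mono_window {W W' R : Set (Slot f)} (hW : W ⊆ W') {d : Slot f}
    (h : L.InGraph W R d) : L.InGraph W' R d := by
  induction h with
  | root hv hw => exact .root hv (hW hw)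
  | dep _ hu hd hw ih => exact ih.dep hu hd (hW hw)
  | hist _ hr hd ih => exact ih.hist hr hd

theorem InGraph.restrict {W W' R : Set (Slot f)} (hW : ∀ d, L.InGraph W R d → d ∈ W') {d : Slot f}
    (h : L.InGraph W R d) : L.InGraph W' R d := by
  induction h with
  | root hv hw => exact .root hv (hW _ (.root hv hw))
  | dep hi hu hd hw ih => exact ih.dep hu hd (hW _ (hi.dep hu hd hw))
  | hist _ hr hd ih => exact ih.hist hr hd

/-- Ignoring slots outside of a window that contains the full graph does not change the graph. -/
theorem rdeps_eq_rdepsExp {R : Set (Slot f)} (h : ∀ d, L.InGraph Set.univ R d → d ∈ L.window k) :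
    L.rdeps R = L.rdepsExp k R := by
  have hiff (d : Slot f) : L.InGraph Set.univ R d ↔ L.InGraph (L.window k) R d :=
    ⟨InGraph.restrict h, InGraph.mono_window (Set.subset_univ _)⟩
  simp only [rdeps, rdepsExp, depGraph, DepGraph.mk.injEq, hiff]
  refine ⟨trivial, ?_⟩
  congr 1
  ext e
  simp only [Set.mem_ofPred_eq, Set.mem_univ, and_true]
  exact ⟨fun ⟨h1, h2, h3⟩ => ⟨h1, h2, h3,
    h _ (.dep ((hiff _).2 h1) h2 h3 (Set.mem_univ _))⟩, fun ⟨h1, h2, h3, _⟩ => ⟨h1, h2, h3⟩⟩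

section Component

variable [LinearOrder (Slot f)] {W : Set (Slot f)} {v : Slot f} {S : Set (Slot f)}
  {vs : List (Slot f)}

/-- The set `W` is arbitrary above the window so that both execution cases are covered. -/
theorem block_of_isNextSCC (hr : L.RhistClosed) (hW : L.window k ⊆ W)
    (hnodes : ∀ d, L.InGraph W {v} d → d ∉ L.log → d ∈ L.committedSet ∧ d ∈ L.window k)
    (hS : (L.depGraph W {v}).IsNextSCC L.executed S) (hsort : vs.Pairwise (· < ·))
    (hvs : ∀ s, s ∈ vs ↔ s ∈ S) : L.Block k vs := by
  obtain ⟨⟨w, hw, hSeq⟩, hdis, hreach⟩ := hS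
  have hfresh (u : Slot f) (hu : u ∈ S) : u ∉ L.log := fun h => Set.disjoint_left.1 hdis hu h
  have hin (u : Slot f) (hu : u ∈ S) : L.InGraph W {v} u := by
    rw [hSeq] at hu
    exact hu.1
  refine ⟨hsort, fun u hu => hfresh u ((hvs u).1 hu), fun u hu => ?_, fun u hu => ?_,
    fun u hu d hd hdW => ?_, fun A hA hcl y hy => ?_⟩
  · rw [hvs] at hu
    exact (hnodes u (hin u hu) (hfresh u hu)).1
  · rw [hvs] at hu
    exact (hnodes u (hin u hu) (hfresh u hu)).2
  · rw [hvs] at hu ⊢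
    exact hreach u hu d (.single (Or.inl ⟨hin u hu, hfresh u hu, hd, hW hdW⟩))
  · obtain ⟨x, hx, hxA⟩ := hA
    simp only [hvs] at hx hy hcl
    have hpath : (L.depGraph W {v}).Reaches x y := by
      rw [hSeq] at hx hy
      exact hx.2.2.trans hy.2.1
    have key (z : Slot f) (hz : (L.depGraph W {v}).Reaches x z) (hzl : z ∉ L.log) :
        z ∈ S ∧ z ∈ A := by
      induction hz with
      | refl => exact ⟨hx, hxA⟩
      -- Recorded graphs contain executed slots only. An edge into an unexecuted slot is therefore a
      -- dependency edge, and its source is unexecuted as well.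
      | tail hab hbc ih =>
        rename_i b c
        have hcS : c ∈ S := (hreach x hx c (hab.tail hbc)).resolve_right hzl
        rcases hbc with ⟨hb, hbl, hdep, -⟩ | ⟨u, g, -, hg, he⟩
        · obtain ⟨hbS, hbA⟩ := ih hbl
          exact ⟨hcS, hcl b hbS hbA c hcS hdep (hnodes c (hin c hcS) hzl).2⟩
        · exact absurd ((hr u g hg).2.2 _ he).2 hzl
    exact (key y hpath (hfresh y hy)).2

/-- Here the full graph lies inside the window, so restricting it changes nothing and the normal
case becomes an instance of `execBlock`. -/
theorem block_of_normal (hr : L.RhistClosed) (hv : L.NormalOk k v)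
    (hS : (L.rdeps {v}).IsNextSCC L.executed S) (hsort : vs.Pairwise (· < ·))
    (hvs : ∀ s, s ∈ vs ↔ s ∈ S) : L.Block k vs ∧ L.run vs (L.rdeps S) = L.execBlock k vs := by
  refine ⟨block_of_isNextSCC hr (Set.subset_univ _) (fun d hd _ => hv.2 hd) hS hsort hvs, ?_⟩
  obtain rfl : {s | s ∈ vs} = S := Set.ext hvs
  rw [execBlock, rdeps_eq_rdepsExp (k := k)]
  intro d hd
  obtain ⟨w, hw, hSeq⟩ := hS.1
  refine (hv.2 (hd.mono_roots fun r hr => ?_)).2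
  rw [hSeq] at hr
  exact hr.1

theorem block_of_unblock (hr : L.RhistClosed) (hv : L.UnblockOk k v)
    (hS : (L.rdepsExp k {v}).IsNextSCC L.executed S) (hsort : vs.Pairwise (· < ·))
    (hvs : ∀ s, s ∈ vs ↔ s ∈ S) : L.Block k vs ∧ L.run vs (L.rdepsExp k S) = L.execBlock k vs := by
  refine ⟨block_of_isNextSCC hr subset_rfl (fun d hd hdl => ⟨hv.2.2 hd, ?_⟩) hS hsort hvs, ?_⟩
  · cases hd with
    | root _ hw => exact hw
    | dep _ _ _ hw => exact hw
    | hist _ hg hd => exact absurd ((hr _ _ hg).2.1 _ hd) hdl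
  · rw [execBlock, show {s | s ∈ vs} = S from Set.ext hvs]

end Component

namespace Block

variable [LinearOrder (Slot f)] {L' : Local f Req} {vs vs' : List (Slot f)}

/-- If a slot of the block has a dependency outside of the window, then the oldest slot of that
coordinator which is not executed belongs to the block. -/
theorem exp_mem (hb : L.Block k vs) {u d : Slot f} (hu : u ∈ vs) (hd : L.DependsOn u d)
    (hdW : d ∉ L.window k) : (⟨d.co, L.exp d.co⟩ : Slot f) ∈ vs ∧ L.exp d.co + k ≤ d.seq := by
  have hle : L.exp d.co + k ≤ d.seq := not_lt.1 hdW
  -- For `k = 0` the window contains executed slots only, whereas `u` is not executed.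
  have hk : 0 < k := by
    by_contra hk
    have hw : u.seq < L.exp u.co + k := hb.window u hu
    exact hb.fresh u hu (mem_log_of_lt_exp (l := u.co) (by omega))
  refine ⟨(hb.closed u hu _ (hd.of_le (n := L.exp d.co) (by omega)) ?_).resolve_right
    (exp_notMem_log L _), hle⟩
  show L.exp d.co < L.exp d.co + k
  omega

/-- Were `d` beyond the window of `L'`, then `vs'` would contain the oldest slot of `d.co`
unexecuted in `L'`. The window of `L` reaches further, so `L` would have executed that slot. -/
theorem mem_window (hb' : L'.Block k vs') (hE : ∀ x ∈ vs', x ∉ L.log) {u d : Slot f} (hu : u ∈ vs')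
    (hd : L'.DependsOn u d) (hdW : d ∈ L.window k) : d ∈ L'.window k := by
  by_contra hdW'
  obtain ⟨hmem, hle⟩ := hb'.exp_mem hu hd hdW'
  have hlt : d.seq < L.exp d.co + k := hdW
  exact hE _ hmem (mem_log_of_lt_exp (by omega))

/-- Strong connectivity is applied to the set of slots of `vs'`: within `vs` it is closed under
dependencies, because `vs'` is closed and `L'` has executed nothing of `vs`. -/
theorem subset_of_meet (hb : L.Block k vs) (hb' : L'.Block k vs') (hcomp : Compatible L L')
    (hE : ∀ x ∈ vs', x ∉ L.log) (hE' : ∀ x ∈ vs, x ∉ L'.log) (hmeet : ∃ x ∈ vs, x ∈ vs') :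
    ∀ x ∈ vs, x ∈ vs' := by
  refine hb.connected {x | x ∈ vs'} hmeet fun a _ ha' d hd hdep hdW => ?_
  have hdep' := hdep.transfer hcomp (hb'.committed a ha')
  exact (hb'.closed a ha' d hdep' (hb'.mem_window hE ha' hdep' hdW)).resolve_right (hE' d hd)

theorem eq_of_meet (hb : L.Block k vs) (hb' : L'.Block k vs') (hcomp : Compatible L L')
    (hE : ∀ x ∈ vs', x ∉ L.log) (hE' : ∀ x ∈ vs, x ∉ L'.log) {x : Slot f} (hx : x ∈ vs)
    (hx' : x ∈ vs') : vs = vs' := by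
  have h1 := hb.subset_of_meet hb' hcomp hE hE' ⟨x, hx, hx'⟩
  have h2 := hb'.subset_of_meet hb hcomp.symm hE' hE ⟨x, hx', hx⟩
  exact hb.sorted.eq_of_mem_iff hb'.sorted fun a => ⟨h1 a, h2 a⟩

/-- The second conclusion strengthens the induction: nodes outside the block are executed in both
states, where the recorded graphs coincide. -/
theorem inGraph_transfer (hb : L.Block k vs) (hb' : L'.Block k vs) (hcomp : Compatible L L')
    (hr : L.RhistClosed) (hr' : L'.RhistClosed)
    (hhist : ∀ v ∈ L.log, v ∈ L'.log → L.rhist v = L'.rhist v) {d : Slot f}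
    (h : L.InGraph (L.window k) {s | s ∈ vs} d) :
    L'.InGraph (L'.window k) {s | s ∈ vs} d ∧ (d ∈ vs ∨ d ∈ L.log ∧ d ∈ L'.log) := by
  induction h with
  | root hv _ => exact ⟨.root hv (hb'.window _ hv), Or.inl hv⟩
  | dep hi hu hd hdW ih =>
    obtain ⟨ih, hmem⟩ := ih
    have huvs := hmem.resolve_right fun h => hu h.1
    have hd' := hd.transfer hcomp (hb'.committed _ huvs)
    have hdW' := hb'.mem_window hb.fresh huvs hd' hdW
    refine ⟨ih.dep (hb'.fresh _ huvs) hd' hdW', ?_⟩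
    rcases hb.closed _ huvs _ hd hdW with h | h
    · exact Or.inl h
    · exact (hb'.closed _ huvs _ hd' hdW').imp id fun h' => ⟨h, h'⟩
  | hist hi hg hd ih =>
    rename_i u d g
    obtain ⟨ih, hmem⟩ := ih
    have hul := (hr _ _ hg).1
    have hul' := (hmem.resolve_left fun h => hb.fresh _ h hul).2
    have hg' : L'.rhist u = some g := (hhist u hul hul') ▸ hg
    exact ⟨ih.hist hg' hd, Or.inr ⟨(hr _ _ hg).2.1 _ hd, (hr' _ _ hg').2.1 _ hd⟩⟩

theorem rdepsExp_le (hb : L.Block k vs) (hb' : L'.Block k vs) (hcomp : Compatible L L')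
    (hr : L.RhistClosed) (hr' : L'.RhistClosed)
    (hhist : ∀ v ∈ L.log, v ∈ L'.log → L.rhist v = L'.rhist v) :
    (L.rdepsExp k {s | s ∈ vs}).nodes ⊆ (L'.rdepsExp k {s | s ∈ vs}).nodes ∧
      (L.rdepsExp k {s | s ∈ vs}).edges ⊆ (L'.rdepsExp k {s | s ∈ vs}).edges := by
  refine ⟨fun d hd => (hb.inGraph_transfer hb' hcomp hr hr' hhist hd).1, fun e he => ?_⟩
  rcases he with ⟨hi, hu, hd, hdW⟩ | ⟨u, g, hi, hg, he⟩
  · obtain ⟨hi', hmem⟩ := hb.inGraph_transfer hb' hcomp hr hr' hhist hi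
    have huvs := hmem.resolve_right fun h => hu h.1
    have hd' := hd.transfer hcomp (hb'.committed _ huvs)
    exact Or.inl ⟨hi', hb'.fresh _ huvs, hd', hb'.mem_window hb.fresh huvs hd' hdW⟩
  · obtain ⟨hi', hmem⟩ := hb.inGraph_transfer hb' hcomp hr hr' hhist hi
    have hul := (hr _ _ hg).1
    have hul' := (hmem.resolve_left fun h => hb.fresh _ h hul).2
    exact Or.inr ⟨u, g, hi', (hhist u hul hul') ▸ hg, he⟩

theorem rdepsExp_eq (hb : L.Block k vs) (hb' : L'.Block k vs) (hcomp : Compatible L L')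
    (hr : L.RhistClosed) (hr' : L'.RhistClosed)
    (hhist : ∀ v ∈ L.log, v ∈ L'.log → L.rhist v = L'.rhist v) :
    L.rdepsExp k {s | s ∈ vs} = L'.rdepsExp k {s | s ∈ vs} := by
  have h1 := hb.rdepsExp_le hb' hcomp hr hr' hhist
  have h2 := hb'.rdepsExp_le hb hcomp.symm hr' hr fun v hv hv' => (hhist v hv' hv).symm
  exact DepGraph.mk.injEq .. |>.mpr ⟨h1.1.antisymm h2.1, h1.2.antisymm h2.2⟩

theorem mem_of_inGraph (hb : L.Block k vs) (hr : L.RhistClosed) {d : Slot f}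
    (h : L.InGraph (L.window k) {s | s ∈ vs} d) : d ∈ vs ∨ d ∈ L.log := by
  induction h with
  | root hv _ => exact Or.inl hv
  | dep _ hu hd hdW ih => exact hb.closed _ (ih.resolve_right hu) _ hd hdW
  | hist _ hg hd _ => exact Or.inr ((hr _ _ hg).2.1 _ hd)

theorem rhistClosed (hb : L.Block k vs) (hr : L.RhistClosed) :
    (L.execBlock k vs).RhistClosed := by
  intro v g hg
  have hlog (x : Slot f) (hx : x ∈ vs ∨ x ∈ L.log) : x ∈ (L.execBlock k vs).log :=
    List.mem_append.2 hx.symm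
  simp only [execBlock, run] at hg
  split_ifs at hg with hv
  · obtain rfl := Option.some.inj hg
    refine ⟨hlog v (Or.inl hv), fun d hd => hlog d (hb.mem_of_inGraph hr hd), fun e he => ?_⟩
    rcases he with ⟨hi, hu, hd, hdW⟩ | ⟨u, g, -, hg, he⟩
    · exact ⟨hlog _ (hb.mem_of_inGraph hr hi), hlog _ (hb.mem_of_inGraph hr (hi.dep hu hd hdW))⟩
    · have := (hr _ _ hg).2.2 e he
      exact ⟨hlog _ (Or.inr this.1), hlog _ (Or.inr this.2)⟩
  · obtain ⟨h1, h2, h3⟩ := hr v g hg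
    exact ⟨hlog v (Or.inr h1), fun d hd => hlog d (Or.inr (h2 d hd)),
      fun e he => (h3 e he).imp (fun h => hlog _ (Or.inr h)) fun h => hlog _ (Or.inr h)⟩

end Block

end Local

/-! ### Execution histories and the common order -/

theorem pair_sublist_append {α : Type*} {l₁ l₂ : List α} {x y : α} (hx : x ∈ l₁) (hy : y ∈ l₂) :
    [x, y].Sublist (l₁ ++ l₂) :=
  (List.singleton_sublist.2 hx).append (List.singleton_sublist.2 hy)

variable [LinearOrder (Slot f)]

/-- `L` arises from an execution history in which the executed slot `v` was part of the block
`c v`. -/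
inductive History (k : ℕ) : Local f Req → (Slot f → List (Slot f)) → Prop
  | empty {L : Local f Req} : L.log = [] → (∀ v, L.rhist v = none) → History k L fun _ => []
  | agree {L L' : Local f Req} {c : Slot f → List (Slot f)} : History k L c → L'.log = L.log →
      L'.rhist = L.rhist →
      (∀ s x, (L.slots s).committed = some x → (L'.slots s).committed = some x) → History k L' c
  | exec {L : Local f Req} {c : Slot f → List (Slot f)} (vs : List (Slot f)) : History k L c →
      L.Block k vs → History k (L.execBlock k vs) fun v => if v ∈ vs then vs else c v

namespace History

variable {k : ℕ} {L L' : Local f Req} {c c' : Slot f → List (Slot f)}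

theorem rhistClosed (h : History k L c) : L.RhistClosed := by
  induction h with
  | empty _ hr => intro v g hg; rw [hr] at hg; cases hg
  | agree _ hl hr _ ih => intro v g hg; rw [hr] at hg; rw [hl]; exact ih v g hg
  | exec vs _ hb ih => exact hb.rhistClosed ih

theorem committed (h : History k L c) {v : Slot f} (hv : v ∈ L.log) : v ∈ L.committedSet := by
  induction h with
  | empty hl _ => rw [hl] at hv; cases hv
  | agree _ hl _ hc ih =>
    rw [hl] at hv
    obtain ⟨x, hx⟩ := Option.isSome_iff_exists.1 (ih hv)
    exact Option.isSome_iff_exists.2 ⟨x, hc _ _ hx⟩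
  | exec vs _ hb ih =>
    rcases List.mem_append.1 hv with hv | hv
    · exact ih hv
    · exact hb.committed v hv

/-- `c` partitions the executed slots into blocks; a new block is fresh and so leaves the older ones
untouched. -/
theorem comp_spec (h : History k L c) {v : Slot f} (hv : v ∈ L.log) :
    v ∈ c v ∧ ∀ x ∈ c v, x ∈ L.log ∧ c x = c v := by
  induction h with
  | empty hl _ => rw [hl] at hv; cases hv
  | agree _ hl _ _ ih => rw [hl] at hv ⊢; exact ih hv
  | exec vs _ hb ih =>
    by_cases hvs : v ∈ vs
    · simp only [hvs, if_true, true_and]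
      intro x hx
      simp only [hx, if_true, and_true]
      exact List.mem_append.2 (Or.inr hx)
    · have hv := (List.mem_append.1 hv).resolve_right hvs
      obtain ⟨h1, h2⟩ := ih hv
      simp only [hvs, if_false]
      refine ⟨h1, fun x hx => ?_⟩
      have hx' : x ∉ vs := fun h => hb.fresh x h (h2 x hx).1
      simp only [hx', if_false]
      exact ⟨List.mem_append.2 (Or.inl (h2 x hx).1), (h2 x hx).2⟩

/-- Slots of the same block are executed in their given order. -/
theorem sublist_of_lt (h : History k L c) {u : Slot f} (hu : u ∈ L.log)
    {x y : Slot f} (hx : x ∈ c u) (hy : y ∈ c u) (hxy : x < y) : [x, y].Sublist L.log := by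
  induction h with
  | empty hl _ => rw [hl] at hu; cases hu
  | agree _ hl _ _ ih => rw [hl] at hu ⊢; exact ih hu hx hy
  | exec vs _ hb ih =>
    by_cases hvs : u ∈ vs
    · simp only [hvs, if_true] at hx hy
      have hs : [x, y].Sublist vs := by
        obtain ⟨l₁, l₂, rfl⟩ := List.append_of_mem hx
        have hsort := hb.sorted
        rw [List.pairwise_append] at hsort
        rcases List.mem_append.1 hy with hy | hy
        · exact absurd (hsort.2.2 y hy x (by simp)) hxy.asymm
        · rcases List.mem_cons.1 hy with rfl | hy
          · exact absurd hxy (lt_irrefl _)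
          · exact List.sublist_append_of_sublist_right
              ((List.singleton_sublist.2 hy).cons_cons x)
      exact List.sublist_append_of_sublist_right hs
    · simp only [hvs, if_false] at hx hy
      exact List.sublist_append_of_sublist_left
        (ih ((List.mem_append.1 hu).resolve_right hvs) hx hy)

/-- If `v` is executed, then a slot that is older by at least the size of the window is executed
before, and so is its whole block. -/
theorem sublist_of_window (h : History k L c) {v : Slot f} (hv : v ∈ L.log) {n : ℕ}
    (hn : n + k ≤ v.seq) :
    (⟨v.co, n⟩ : Slot f) ∈ L.log ∧ ∀ x ∈ c ⟨v.co, n⟩, [x, v].Sublist L.log := by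
  induction h with
  | empty hl _ => rw [hl] at hv; cases hv
  | agree _ hl _ _ ih => rw [hl] at hv ⊢; exact ih hv
  | exec vs h hb ih =>
    rename_i L c
    have key : (⟨v.co, n⟩ : Slot f) ∈ L.log ∧
        ∀ x ∈ c ⟨v.co, n⟩, [x, v].Sublist (L.execBlock k vs).log := by
      rcases List.mem_append.1 hv with hv | hv
      · exact ⟨(ih hv).1, fun x hx => List.sublist_append_of_sublist_left ((ih hv).2 x hx)⟩
      · have hw : v.seq < L.exp v.co + k := hb.window v hv
        have hmem : (⟨v.co, n⟩ : Slot f) ∈ L.log := Local.mem_log_of_lt_exp (by omega)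
        exact ⟨hmem, fun x hx => pair_sublist_append ((h.comp_spec hmem).2 x hx).1 hv⟩
    have hnot : (⟨v.co, n⟩ : Slot f) ∉ vs := fun hm => hb.fresh _ hm key.1
    simp only [hnot, if_false]
    exact ⟨List.mem_append.2 (Or.inl key.1), key.2⟩

/-- A dependency of an executed slot is in the same block, or executed before, or so far ahead that
the window did not contain it. -/
theorem dependsOn_cases (h : History k L c) {u v : Slot f} (hu : u ∈ L.log)
    (hd : L.DependsOn u v) : v ∈ c u ∨ [v, u].Sublist L.log ∨
      ∃ n, (⟨v.co, n⟩ : Slot f) ∈ c u ∧ n + k ≤ v.seq := by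
  induction h with
  | empty hl _ => rw [hl] at hu; cases hu
  | agree h hl _ hc ih =>
    rw [hl] at hu ⊢
    -- An executed slot was already committed in the earlier state, so later commits give it no new
    -- dependencies.
    exact ih hu (hd.transfer (fun s x y hx hy => Option.some.inj (hx.symm.trans (hc _ _ hy)))
      (h.committed hu))
  | exec vs h hb ih =>
    rename_i L c
    have hd : L.DependsOn u v := hd
    by_cases hvs : u ∈ vs
    · simp only [hvs, if_true]
      by_cases hW : v ∈ L.window k
      · exact (hb.closed u hvs v hd hW).imp id fun hv => Or.inl (pair_sublist_append hv hvs)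
      · exact Or.inr (Or.inr ⟨_, hb.exp_mem hvs hd hW⟩)
    · simp only [hvs, if_false]
      exact (ih ((List.mem_append.1 hu).resolve_right hvs) hd).imp id
        (Or.imp List.sublist_append_of_sublist_left id)

/-- Slots that are executed in two histories are executed in the same block with the same
dependency graph. -/
theorem consistent (h : History k L c) (h' : History k L' c') (hcomp : L.Compatible L') {v : Slot f}
    (hv : v ∈ L.log) (hv' : v ∈ L'.log) : L.rhist v = L'.rhist v ∧ c v = c' v := by
  induction h generalizing L' c' v with
  | empty hl _ => rw [hl] at hv; cases hv
  | agree _ hl hr hc ih =>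
    rw [hl] at hv
    rw [hr]
    exact ih h' (fun s x y hx hy => hcomp s x y (hc s x hx) hy) hv hv'
  | exec vs h hb ih =>
    rename_i L c
    -- The inner induction shortens the second history; the outer hypothesis `ih` remains available
    -- for any second history.
    induction h' generalizing v with
    | empty hl _ => rw [hl] at hv'; cases hv'
    | agree _ hl hr hc ih' =>
      rw [hl] at hv'
      rw [hr]
      exact ih' (fun s x y hx hy => hcomp s x y hx (hc s y hy)) hv hv'
    | exec vs' h' hb' ih' =>
      rename_i L' c'
      have hcomp : L.Compatible L' := hcomp
      have old (x : Slot f) (hx : x ∈ L.log) (hx' : x ∈ (L'.execBlock k vs').log) :=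
        ih (h'.exec vs' hb') hcomp hx hx'
      by_cases hvs : v ∈ vs
      · by_cases hvs' : v ∈ vs'
        -- Had `L` executed `x` earlier, the block of `x` would be `vs'` in both histories. It
        -- contains `v`, which `L` has not executed.
        · have hE (x : Slot f) (hx : x ∈ vs') : x ∉ L.log := fun hxl => by
            have hcx := (old x hxl (List.mem_append.2 (Or.inr hx))).2
            simp only [hx, if_true] at hcx
            exact hb.fresh v hvs ((h.comp_spec hxl).2 v (hcx ▸ hvs')).1
          have hE' (x : Slot f) (hx : x ∈ vs) : x ∉ L'.log := fun hxl => by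
            have hcx := (ih' hcomp (List.mem_append.2 (Or.inr hx)) hxl).2
            simp only [hx, if_true] at hcx
            exact hb'.fresh v hvs' ((h'.comp_spec hxl).2 v (hcx ▸ hvs)).1
          obtain rfl := hb.eq_of_meet hb' hcomp hE hE' hvs hvs'
          have hg := hb.rdepsExp_eq hb' hcomp h.rhistClosed h'.rhistClosed
            fun x hx hx' => (ih h' hcomp hx hx').1
          simp only [Local.execBlock, Local.run, hvs, if_true, hg, and_self]
        · have hv' := (List.mem_append.1 hv').resolve_right hvs'
          have := ih' hcomp hv hv'
          simpa only [Local.execBlock, Local.run, hvs', if_false] using this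
      · have hv := (List.mem_append.1 hv).resolve_right hvs
        have := old v hv hv'
        simpa only [Local.execBlock, Local.run, hvs, if_false] using this

end History

/-- The execution order of a slot and its dependency is the same in all histories. -/
theorem execution_order {ι : Type*} {k : ℕ} {L : ι → Local f Req} {c : ι → Slot f → List (Slot f)}
    (h : ∀ i, History k (L i) (c i)) (hcomp : ∀ i j, (L i).Compatible (L j)) {u v : Slot f}
    (huv : u ≠ v) (hd : ∀ i, u ∈ (L i).log → (L i).DependsOn u v) :
    (∀ i, v ∈ (L i).log → [u, v].Sublist (L i).log) ∨
      ∀ i, u ∈ (L i).log → [v, u].Sublist (L i).log := by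
  by_cases hahead : ∃ i, u ∈ (L i).log ∧ ∃ n, (⟨v.co, n⟩ : Slot f) ∈ c i u ∧ n + k ≤ v.seq
  · obtain ⟨i, hu, n, hn, hle⟩ := hahead
    refine Or.inl fun j hv => ?_
    obtain ⟨hmem, hsub⟩ := (h j).sublist_of_window hv hle
    obtain ⟨hmem', heq⟩ := ((h i).comp_spec hu).2 _ hn
    refine hsub u ?_
    -- Blocks agree across replicas, so at `j` too `u` belongs to the block of the older slot.
    rw [← ((h i).consistent (h j) (hcomp i j) hmem' hmem).2, heq]
    exact ((h i).comp_spec hu).1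
  by_cases hblock : ∃ i, u ∈ (L i).log ∧ v ∈ c i u
  · obtain ⟨i, hu, hv⟩ := hblock
    obtain ⟨hvl, hcv⟩ := ((h i).comp_spec hu).2 v hv
    have huc := ((h i).comp_spec hu).1
    rcases lt_or_gt_of_ne huv with hlt | hlt
    · refine Or.inl fun j hvj => ?_
      have heq := ((h i).consistent (h j) (hcomp i j) hvl hvj).2
      rw [hcv] at heq
      exact (h j).sublist_of_lt hvj (heq ▸ huc) (heq ▸ hv) hlt
    · refine Or.inr fun j huj => ?_
      have heq := ((h i).consistent (h j) (hcomp i j) hu huj).2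
      exact (h j).sublist_of_lt huj (heq ▸ hv) (heq ▸ huc) hlt
  · refine Or.inr fun i hu => ?_
    rcases (h i).dependsOn_cases hu (hd i hu) with h1 | h1 | h1
    · exact absurd ⟨i, hu, h1⟩ hblock
    · exact h1
    · exact absurd ⟨i, hu, h1⟩ hahead

/-! ### Reachable states and the conclusion -/

/-- In a reachable state the agreement invariant holds, and every correct replica has an execution
history. -/
theorem Reachable.invariant {conflict : Req → Req → Prop}
    (conflict_symm : ∀ a b, conflict a b → conflict b a) {k : ℕ} {faulty : Finset (Rep f)}
    (hf : faulty.card ≤ f) {σ : State f Req} (hσ : Reachable conflict k faulty σ) :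
    AgreeInv conflict faulty σ ∧ ∀ i ∉ faulty, ∃ c, History k (σ.loc i) c := by
  induction hσ with
  | refl => exact ⟨AgreeInv.start, fun i _ => ⟨_, .empty rfl fun _ => rfl⟩⟩
  | tail _ hs ih =>
    obtain ⟨ha, hh⟩ := ih
    have ha' := ha.step conflict_symm hf hs
    refine ⟨ha', fun j hj => ?_⟩
    obtain ⟨c, hc⟩ := hh j hj
    cases hs with
    | byzantine m hm => exact ⟨c, hc⟩
    | correct i L' out hi hl =>
      rename_i σ _
      by_cases hji : j = i
      · subst hji
        have hcom (s : Slot f) (x : Option Req × Deps f)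
            (hx : ((σ.loc j).slots s).committed = some x) : (L'.slots s).committed = some x := by
          obtain ⟨y, hy⟩ := Option.isSome_iff_exists.1
            (hl.committed_isSome (Option.isSome_iff_exists.2 ⟨x, hx⟩))
          have hd := (ha.committed j hj s x.1 x.2 hx).mono (Set.subset_union_left (t := out))
          have hd' := ha'.committed j hj s y.1 y.2 (by simpa using hy)
          rw [hy, Prod.ext_iff.2 (ha'.sane.decided_unique hf hd hd')]
        simp only [Function.update_self]
        cases hl
        case execNormal v S vs hv hS hsort hvs =>
          obtain ⟨hb, heq⟩ := Local.block_of_normal hc.rhistClosed hv hS hsort hvs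
          rw [heq]
          exact ⟨_, hc.exec vs hb⟩
        case execUnblock v S vs _ hv hS hsort hvs =>
          obtain ⟨hb, heq⟩ := Local.block_of_unblock hc.rhistClosed hv hS hsort hvs
          rw [heq]
          exact ⟨_, hc.exec vs hb⟩
        all_goals exact ⟨c, hc.agree rfl rfl hcom⟩
      · simp only [Function.update_of_ne hji]
        exact ⟨c, hc⟩

end Isos

theorem mainTheorem2 {f : ℕ} {Req : Type} [LinearOrder (Isos.Slot f)]
    (conflict : Req → Req → Prop) (conflict_symm : ∀ a b, conflict a b → conflict b a)
    (k : ℕ) (faulty : Finset (Isos.Rep f)) (faulty_le : faulty.card ≤ f)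
    (σ : Isos.State f Req) (reachable : Isos.Reachable conflict k faulty σ) :
    (∀ i ∉ faulty, ∀ j ∉ faulty, ∀ (u v : Isos.Slot f) (a b : Req) (D D' : Isos.Deps f),
      u ≠ v → σ.Committed i u a D → σ.Committed j v b D' → conflict a b →
        -- the two slots are connected by a dependency
        (D.Has v ∨ D'.Has u) ∧
        -- and one of the two comes first on all correct replicas
        ((∀ l ∉ faulty, σ.Executed l v → σ.ExecutedBefore l u v) ∨
          (∀ l ∉ faulty, σ.Executed l u → σ.ExecutedBefore l v u))) ∧
    -- correct replicas execute a slot with the same dependency graph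
    (∀ i ∉ faulty, ∀ j ∉ faulty, ∀ v : Isos.Slot f, σ.Executed i v → σ.Executed j v →
      (σ.loc i).rhist v = (σ.loc j).rhist v) := by
  obtain ⟨ha, hh⟩ := reachable.invariant conflict_symm faulty_le
  choose c hc using hh
  have hcomp (i : {i // i ∉ faulty}) (j : {j // j ∉ faulty}) :
      (σ.loc i).Compatible (σ.loc j) := fun s x y hx hy =>
    ha.committed_unique faulty_le i.2 j.2 hx hy
  -- Whoever has executed `u` has committed it, with the same dependencies as `i`; so the dependency
  -- on `v` holds at all these replicas.
  have order (i : Isos.Rep f) (hi : i ∉ faulty) (u v : Isos.Slot f) (a : Req) (D : Isos.Deps f)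
      (huv : u ≠ v) (hu : σ.Committed i u a D) (hD : D.Has v) :=
    Isos.execution_order (L := fun l : {l // l ∉ faulty} => σ.loc l) (fun l => hc l l.2) hcomp huv
      fun l hl => Isos.Local.DependsOn.transfer (hcomp ⟨i, hi⟩ l) ⟨_, D, hu, hD⟩
        ((hc l l.2).committed hl)
  refine ⟨fun i hi j hj u v a b D D' huv hu hv hab => ?_, fun i hi j hj v hvi hvj =>
    ((hc i hi).consistent (hc j hj) (hcomp ⟨i, hi⟩ ⟨j, hj⟩) hvi hvj).1⟩
  have hdep := ha.has_or_has faulty_le hi hj huv hu hv hab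
  refine ⟨hdep, ?_⟩
  rcases hdep with hD | hD
  · exact (order i hi u v a D huv hu hD).imp (fun h l hl => h ⟨l, hl⟩) fun h l hl => h ⟨l, hl⟩
  · exact (order j hj v u b D' huv.symm hv hD).symm.imp (fun h l hl => h ⟨l, hl⟩)
      fun h l hl => h ⟨l, hl⟩
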